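/- \textbf{Setting.} A game has player set $N=\{0,\dots,n-1\}$. Each player $i$ has two disjoint sets $N_i^+$ (friends) and $N_i^-$ (enemies) of other players, and a complete preorder $\unrhd_i$ (ties allowed) on each of $N_i^+$ and $N_i^-$; all other players are neutral for $i$. Put $N_i=N_i^+\cup N_i^-$. There is a constant $d$ with $|N_i|\le d$ for all $i$. The in-degree of $j$ is $|\{i : j\in N_i\}|$. For a complete preorder $\sigma$ on a finite set, a strict linear order resolves $\sigma$ if it contains the strict part of $\sigma$. Let $\tau(\alpha,\beta)=|\{(x,y): x\mathrel{\alpha}y,\ y\mathrel{\beta}x\}|$ for strict linear orders, and let $\vec\tau(\pi,\sigma)=\max_{\beta\text{ resolves }\sigma}\ \min_{\alpha\text{ resolves }\pi}\tau(\alpha,\beta)$. Write $\langle X\mid i\mid Y\rangle$ for the order listing first $X$, then $i$, then $Y$, and $\overline{\unrhd}_i$ for the reverse of $\unrhd_i$. For a coalition $C\ni i$ define $$\delta_i(C)=\vec\tau\bigl(\langle \unrhd_i(N_i^+)\mid i\mid\ \rangle,\langle\unrhd_i(C\cap N_i^+)\mid i\mid\overline{\unrhd}_i(N_i^+\setminus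 C)\rangle\bigr)+\vec\tau\bigl(\langle\ \mid i\mid\unrhd_i(N_i^-)\rangle,\langle\overline{\unrhd}_i(C\cap N_i^-)\mid i\mid\unrhd_i(N_i^-\setminus C)\rangle\bigr).$$ Player $i$ weakly prefers $A$ to $B$, written $A\succeq_i B$, iff $\delta_i(A)\le\delta_i(B)$, and prefers $A$ to $B$ iff $A\succeq_i B$ but not $B\succeq_i A$. A coalition structure $\Gamma$ is a partition of $N$; $\Gamma(i)$ is the coalition of $i$. Consider pairs $(i,C)$ with $C\in\Gamma\cup\{\emptyset\}$ such that $i$ prefers $C\cup\{i\}$ to $\Gamma(i)$. $\Gamma$ is \emph{Nash stable} if there is no such pair; \emph{individually stable} if there is no such pair with $C\cup\{i\}\succeq_j C$ for all $j\in C$; and \emph{contractually individually stable} if there is no such pair that satisfies the latter condition and also $\Gamma(i)\setminus\{i\}\succeq_j\Gamma(i)$ for all $j\in\Gamma(i)\setminus\{i\}$. Running time is the number of unit-cost steps of a random access machine (addition, truncated subtraction, comparison, memory access, assignment, tests) on words of $O(\log n)$ bits. The input consists of $n$, for each $i$ the list, in any order, of the players in $N_i$, each with its sign (friend or enemy) and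 its position in $\unrhd_i$ (a number in $\{0,\dots,n\}$), and for each $i$ a label in $\{0,\dots,n-1\}$ of its coalition in $\Gamma$. It does not contain the lists of players who know $i$. \textbf{Theorem.} Given a game and a coalition structure $\Gamma$: \begin{itemize} \item It can be decided in time $O(n)$ whether $\Gamma$ is Nash stable. \item If all in-degrees are at most a constant $k$, it can be decided in time $O(n)$ whether $\Gamma$ is individually stable, and in time $O(n)$ whether $\Gamma$ is contractually individually stable. \item Without any bound on the in-degrees, it can be decided in time $O(n^2)$ whether $\Gamma$ is individually stable, and in time $O(n^2)$ whether $\Gamma$ is contractually individually stable. \end{itemize} In each case there is one program for all values of the constants; the constants in $O(\cdot)$ depend only on $d$ (and on $k$ in the second item). -/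

import Mathlib

open Finset

namespace FEN

/-! ## Orders and distances -/

section Distance

variable {V : Type*}

/-- The strict part of a preference order. -/
def Strict (r : V → V → Prop) (x y : V) : Prop := r x y ∧ ¬ r y x

/-- `α` is a strict (antisymmetric) linear order that is consistent with the preference order `r`:
it keeps every strict preference of `r` and breaks every tie in some way. -/
def Resolves (α r : V → V → Prop) : Prop :=
  IsStrictTotalOrder V α ∧ ∀ x y, Strict r x y → α x y

/-- The Kendall-tau distance of two strict orders: the number of pairs ordered oppositely. -/
noncomputable def kendallTau (α β : V → V → Prop) : ℕ :=
  {p : V × V | α p.1 p.2 ∧ β p.2 p.1}.ncard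

/-- The directed Hausdorff-Kendall-tau distance
`max_{β resolving s} min_{α resolving r} τ(α, β)`. -/
noncomputable def directedTau (r s : V → V → Prop) : ℕ :=
  ⨆ β : {β : V → V → Prop // Resolves β s}, ⨅ α : {α : V → V → Prop // Resolves α r},
    kendallTau α.1 β.1

/-- The order `⟨ rA on A | i | rB on B ⟩`: first the members of `A`, ordered by `rA`, then the
player `i`, then the members of `B`, ordered by `rB`. -/
def ballot (A : Finset V) (rA : V → V → Prop) (i : V) (B : Finset V) (rB : V → V → Prop) :
    V → V → Prop := fun x y =>
  (x ∈ A ∧ y ∈ A ∧ rA x y) ∨ (x ∈ A ∧ (y = i ∨ y ∈ B)) ∨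
    (x = i ∧ (y = i ∨ y ∈ B)) ∨ (x ∈ B ∧ y ∈ B ∧ rB x y)

/-- The directed distance of the restrictions of two orders to the players in `S`. -/
noncomputable def directedTauOn (S : Finset V) (r s : V → V → Prop) : ℕ :=
  directedTau (fun x y : S => r x y) (fun x y : S => s x y)

end Distance

/-! ## FEN-hedonic games with distance-based preferences -/

/-- The encoded opinions of the players `0, …, n - 1`: each player `i` has disjoint sets of friends
and enemies among the other players (all others are neutral), and a complete preorder
(ties allowed) on each of the two sets. `pref i j k` means that `i` weakly prefers `j` to `k`; it is
only used for `j`, `k` both friends or both enemies of `i`. -/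
structure Game (n : ℕ) where
  friends : Fin n → Finset (Fin n)
  enemies : Fin n → Finset (Fin n)
  pref : Fin n → Fin n → Fin n → Prop
  not_mem_friends : ∀ i, i ∉ friends i
  not_mem_enemies : ∀ i, i ∉ enemies i
  disjoint : ∀ i, Disjoint (friends i) (enemies i)
  friends_total : ∀ i, ∀ j ∈ friends i, ∀ k ∈ friends i, pref i j k ∨ pref i k j
  friends_trans : ∀ i, ∀ j ∈ friends i, ∀ k ∈ friends i, ∀ l ∈ friends i,
    pref i j k → pref i k l → pref i j l
  enemies_total : ∀ i, ∀ j ∈ enemies i, ∀ k ∈ enemies i, pref i j k ∨ pref i k j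
  enemies_trans : ∀ i, ∀ j ∈ enemies i, ∀ k ∈ enemies i, ∀ l ∈ enemies i,
    pref i j k → pref i k l → pref i j l

/-- A coalition structure: a partition of the players into nonempty coalitions. -/
abbrev CoalitionStructure (n : ℕ) := Finpartition (univ : Finset (Fin n))

namespace Game

variable {n : ℕ} (G : Game n)

/-- The neighbourhood of `i`: the players known to `i`. -/
def known (i : Fin n) : Finset (Fin n) := G.friends i ∪ G.enemies i

/-- Every player knows at most `d` players. -/
def OutDegreeLE (d : ℕ) : Prop := ∀ i, #(G.known i) ≤ d

/-- Every player is known by at most `k` players. -/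
def InDegreeLE (k : ℕ) : Prop := ∀ j, #{i | j ∈ G.known i} ≤ k

/-- `i`'s reversed preference order. -/
def rev (i : Fin n) : Fin n → Fin n → Prop := fun j k => G.pref i k j

/-- `i`'s ballot on the friends, `⟨ ⊵ on N⁺ | i | ⟩`. -/
def prefPlus (i : Fin n) : Fin n → Fin n → Prop :=
  ballot (G.friends i) (G.pref i) i ∅ (G.pref i)

/-- `i`'s ballot on the enemies, `⟨ | i | ⊵ on N⁻ ⟩`. -/
def prefMinus (i : Fin n) : Fin n → Fin n → Prop :=
  ballot ∅ (G.pref i) i (G.enemies i) (G.pref i)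

/-- The coalition `C` seen by `i`, friends: `⟨ ⊵ on C ∩ N⁺ | i | reversed ⊵ on N⁺ \ C ⟩`. -/
def coalPlus (i : Fin n) (C : Finset (Fin n)) : Fin n → Fin n → Prop :=
  ballot (C ∩ G.friends i) (G.pref i) i (G.friends i \ C) (G.rev i)

/-- The coalition `C` seen by `i`, enemies: `⟨ reversed ⊵ on C ∩ N⁻ | i | ⊵ on N⁻ \ C ⟩`. -/
def coalMinus (i : Fin n) (C : Finset (Fin n)) : Fin n → Fin n → Prop :=
  ballot (C ∩ G.enemies i) (G.rev i) i (G.enemies i \ C) (G.pref i)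

/-- The distance `δ = δ⁺ + δ⁻` between player `i`'s preferences and the coalition `C`. -/
noncomputable def delta (i : Fin n) (C : Finset (Fin n)) : ℕ :=
  directedTauOn (insert i (G.friends i)) (G.prefPlus i) (G.coalPlus i C) +
    directedTauOn (insert i (G.enemies i)) (G.prefMinus i) (G.coalMinus i C)

/-- `i` weakly prefers the coalition `A` to the coalition `B` (both containing `i`). -/
def WeaklyPrefers (i : Fin n) (A B : Finset (Fin n)) : Prop := G.delta i A ≤ G.delta i B

/-- `i` (strictly) prefers the coalition `A` to the coalition `B`. -/
def Prefers (i : Fin n) (A B : Finset (Fin n)) : Prop :=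
  G.WeaklyPrefers i A B ∧ ¬ G.WeaklyPrefers i B A

/-- `i` wants to leave its coalition and join `C`, which is a coalition of `Γ` or empty
(then `i` stays alone). -/
def Deviation (Γ : CoalitionStructure n) (i : Fin n) (C : Finset (Fin n)) : Prop :=
  (C ∈ Γ.parts ∨ C = ∅) ∧ G.Prefers i (insert i C) (Γ.part i)

/-- `i` is welcome in `C`: no member of `C` objects to `i` joining. -/
def Welcome (i : Fin n) (C : Finset (Fin n)) : Prop :=
  ∀ j ∈ C, G.WeaklyPrefers j (insert i C) C

/-- `i` is not bound to its coalition: no other member objects to `i` leaving. -/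
def NotBound (Γ : CoalitionStructure n) (i : Fin n) : Prop :=
  ∀ j ∈ (Γ.part i).erase i, G.WeaklyPrefers j ((Γ.part i).erase i) (Γ.part i)

def NashStable (Γ : CoalitionStructure n) : Prop :=
  ∀ i C, ¬ G.Deviation Γ i C

def IndividuallyStable (Γ : CoalitionStructure n) : Prop :=
  ∀ i C, ¬ (G.Deviation Γ i C ∧ G.Welcome i C)

def ContractuallyIndividuallyStable (Γ : CoalitionStructure n) : Prop :=
  ∀ i C, ¬ (G.Deviation Γ i C ∧ G.Welcome i C ∧ G.NotBound Γ i)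

end Game

/-! ## A random access machine with a step count

Programs are structured programs over registers and a fixed finite number of arrays (those that
occur in the program), all holding natural numbers. Every arithmetic operation, comparison, memory
access, test and assignment costs one step. A run is only defined if every number it handles is a
machine word, i.e. is less than the word bound `W`. -/

/-- Contents of the registers and of the arrays: `arr a x` is the entry of array `a` at `x`. -/
structure State where
  reg : ℕ → ℕ
  arr : ℕ → ℕ → ℕ

namespace State

def setReg (σ : State) (r v : ℕ) : State :=
  { σ with reg := Function.update σ.reg r v }

def setArr (σ : State) (a x v : ℕ) : State :=
  { σ with arr := Function.update σ.arr a (Function.update (σ.arr a) x v) }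

end State

/-- Expressions: constants, registers, array reads, sum, truncated difference, comparisons. -/
inductive Expr where
  | lit (v : ℕ)
  | reg (r : ℕ)
  | get (a : ℕ) (x : Expr)
  | plus (x y : Expr)
  | minus (x y : Expr)
  | lt (x y : Expr)
  | eq (x y : Expr)

namespace Expr

def eval (σ : State) : Expr → ℕ
  | lit v => v
  | reg r => σ.reg r
  | get a x => σ.arr a (x.eval σ)
  | plus x y => x.eval σ + y.eval σ
  | minus x y => x.eval σ - y.eval σ
  | lt x y => if x.eval σ < y.eval σ then 1 else 0
  | eq x y => if x.eval σ = y.eval σ then 1 else 0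

/-- The number of steps needed to evaluate an expression. -/
def cost : Expr → ℕ
  | lit _ => 1
  | reg _ => 1
  | get _ x => x.cost + 1
  | plus x y => x.cost + y.cost + 1
  | minus x y => x.cost + y.cost + 1
  | lt x y => x.cost + y.cost + 1
  | eq x y => x.cost + y.cost + 1

/-- All values that occur in the evaluation of an expression are less than `W`. -/
def Fits (W : ℕ) (σ : State) : Expr → Prop
  | lit v => v < W
  | reg r => σ.reg r < W
  | get a x => x.Fits W σ ∧ σ.arr a (x.eval σ) < W
  | plus x y => x.Fits W σ ∧ y.Fits W σ ∧ x.eval σ + y.eval σ < W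
  | minus x y => x.Fits W σ ∧ y.Fits W σ
  | lt x y => x.Fits W σ ∧ y.Fits W σ ∧ 1 < W
  | eq x y => x.Fits W σ ∧ y.Fits W σ ∧ 1 < W

end Expr

/-- Programs. -/
inductive Prog where
  | skip
  | assign (r : ℕ) (e : Expr)
  | store (a : ℕ) (x e : Expr)
  | seq (p q : Prog)
  | cond (b : Expr) (p q : Prog)
  | loop (b : Expr) (p : Prog)

/-- `Exec W p σ t σ'`: with word bound `W`, the program `p` started in `σ` halts in `σ'` after
exactly `t` steps. Tests branch on whether the value is nonzero. -/
inductive Exec (W : ℕ) : Prog → State → ℕ → State → Prop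
  | skip (σ : State) : Exec W .skip σ 1 σ
  | assign (σ : State) (r : ℕ) (e : Expr) (he : e.Fits W σ) :
      Exec W (.assign r e) σ (e.cost + 1) (σ.setReg r (e.eval σ))
  | store (σ : State) (a : ℕ) (x e : Expr) (hx : x.Fits W σ) (he : e.Fits W σ) :
      Exec W (.store a x e) σ (x.cost + e.cost + 1) (σ.setArr a (x.eval σ) (e.eval σ))
  | seq {σ₁ σ₂ σ₃ : State} {p q : Prog} {t u : ℕ} (hp : Exec W p σ₁ t σ₂)
      (hq : Exec W q σ₂ u σ₃) : Exec W (.seq p q) σ₁ (t + u) σ₃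
  | cond_true {σ σ' : State} {b : Expr} {p q : Prog} {t : ℕ} (hf : b.Fits W σ)
      (hb : b.eval σ ≠ 0) (hp : Exec W p σ t σ') : Exec W (.cond b p q) σ (b.cost + 1 + t) σ'
  | cond_false {σ σ' : State} {b : Expr} {p q : Prog} {t : ℕ} (hf : b.Fits W σ)
      (hb : b.eval σ = 0) (hq : Exec W q σ t σ') : Exec W (.cond b p q) σ (b.cost + 1 + t) σ'
  | loop_true {σ₁ σ₂ σ₃ : State} {b : Expr} {p : Prog} {t u : ℕ} (hf : b.Fits W σ₁)
      (hb : b.eval σ₁ ≠ 0) (hp : Exec W p σ₁ t σ₂) (hl : Exec W (.loop b p) σ₂ u σ₃) :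
      Exec W (.loop b p) σ₁ (b.cost + 1 + t + u) σ₃
  | loop_false {σ : State} {b : Expr} {p : Prog} (hf : b.Fits W σ) (hb : b.eval σ = 0) :
      Exec W (.loop b p) σ (b.cost + 1) σ

/-- The initial state `σ` holds the game `G` and the coalition structure `Γ`, and nothing else.
The dependency graph is given by adjacency lists: the players known to `i` are listed, in any order,
at the positions `arr 0 i ≤ e < arr 0 (i + 1)`. Position `e` holds the known player (`arr 1 e`),
whether it is a friend or an enemy (`arr 2 e`), and its position in `i`'s order of the friends,
respectively enemies (`arr 3 e`; smaller is better, equal means indifferent). The players are not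
told who knows them. `arr 4 i` is a label in `{0, …, n - 1}` of the coalition of `i`. -/
structure Encodes {n : ℕ} (G : Game n) (Γ : CoalitionStructure n) (σ : State) : Prop where
  size : σ.reg 0 = n
  offset_zero : σ.arr 0 0 = 0
  offset_succ : ∀ i : Fin n, σ.arr 0 (i + 1) = σ.arr 0 i + #(G.known i)
  list_bijOn : ∀ i : Fin n, Set.BijOn (σ.arr 1) (Set.Ico (σ.arr 0 i) (σ.arr 0 (i + 1)))
    {x | ∃ j ∈ G.known i, (j : ℕ) = x}
  sign_friend : ∀ i : Fin n, ∀ e ∈ Set.Ico (σ.arr 0 i) (σ.arr 0 (i + 1)),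
    ∀ j ∈ G.friends i, σ.arr 1 e = j → σ.arr 2 e = 1
  sign_enemy : ∀ i : Fin n, ∀ e ∈ Set.Ico (σ.arr 0 i) (σ.arr 0 (i + 1)),
    ∀ j ∈ G.enemies i, σ.arr 1 e = j → σ.arr 2 e = 0
  rank_le : ∀ e, σ.arr 3 e ≤ n
  rank_iff : ∀ i : Fin n, ∀ e ∈ Set.Ico (σ.arr 0 i) (σ.arr 0 (i + 1)),
    ∀ f ∈ Set.Ico (σ.arr 0 i) (σ.arr 0 (i + 1)), ∀ j k : Fin n, σ.arr 1 e = j → σ.arr 1 f = k →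
    (j ∈ G.friends i ∧ k ∈ G.friends i ∨ j ∈ G.enemies i ∧ k ∈ G.enemies i) →
    (G.pref i j k ↔ σ.arr 3 e ≤ σ.arr 3 f)
  label_lt : ∀ i : Fin n, σ.arr 4 i < n
  label_iff : ∀ i j : Fin n, σ.arr 4 i = σ.arr 4 j ↔ Γ.part i = Γ.part j
  reg_clean : ∀ r, r ≠ 0 → σ.reg r = 0
  offset_clean : ∀ x, n < x → σ.arr 0 x = 0
  list_clean : ∀ e, σ.arr 0 n ≤ e → σ.arr 1 e = 0 ∧ σ.arr 2 e = 0 ∧ σ.arr 3 e = 0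
  label_clean : ∀ x, n ≤ x → σ.arr 4 x = 0
  arr_clean : ∀ a, 5 ≤ a → ∀ x, σ.arr a x = 0

/-- On all games of the class `K` and all coalition structures, in whatever way they are encoded,
the program `p` decides the property `Q` (answer `1` for yes and `0` for no, in register `0`)
within `T n` steps for some `T ∈ O(g)`, on words of `O(log n)` bits. -/
def Prog.DecidesInTime (p : Prog) (K : ∀ n : ℕ, Game n → Prop)
    (Q : ∀ n : ℕ, Game n → CoalitionStructure n → Prop) (g : ℕ → ℝ) : Prop :=
  ∃ (c : ℕ) (T : ℕ → ℕ), (fun n => (T n : ℝ)) =O[Filter.atTop] g ∧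
    ∀ (n : ℕ) (G : Game n) (Γ : CoalitionStructure n), K n G →
      ∀ σ : State, Encodes G Γ σ →
        ∃ (t : ℕ) (σ' : State), Exec ((n + 2) ^ c) p σ t σ' ∧ t ≤ T n ∧
          (Q n G Γ → σ'.reg 0 = 1) ∧ (¬ Q n G Γ → σ'.reg 0 = 0)

end FEN

/-! The directed Hausdorff distance has a closed form. For a fixed `β` the best `α` breaks the ties
of `r` as `β` does, which leaves the strict pairs of `r` that `β` inverts (`iInf_kendallTau`); the
worst `β` breaks the ties of `s` against `r`. So the distance counts the pairs that are strict in
`r` and weakly reversed in `s` (`directedTau_eq_ncard`).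

Hence `delta` is a sum of independent weights (`Game.delta_eq_sum`): a friend outside the coalition
costs one plus the number of friends ranked strictly below it, and an enemy inside costs one plus
the number of enemies ranked strictly above it. A member therefore objects to a newcomer exactly if
the newcomer is its enemy, and to a departure exactly if the leaver is its friend. A coalition
without players known to `i` is worth as much to `i` as the empty one, which has no members to
object; so each player has at most `d + 1` relevant targets (`Game.stableWith_iff`), each evaluated
in time depending on `d` only.

Objections come from players who know `i`, and these are not listed at `i`. A single pass over all
lists records them: an enemy entry of `x` marks the cell (enemy, label of `x`) of a table with rows
of length `n + 1`, and a friend entry within the same coalition marks the friend as bound. The table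
has quadratically many addresses, but memory starts at zero and only the at most `n * d` marked
cells are written. One linear-time program with two flags thus decides all three notions
(`runs_stability`), and the quadratic bounds follow from the linear ones. -/

namespace FEN

/-! ### Closed form of the directed Hausdorff distance -/

section Distance

variable {V : Type*}

/-- The order that follows the strict part of `r` and breaks its ties according to `β`. -/
def lexOrder (r β : V → V → Prop) (x y : V) : Prop := Strict r x y ∨ (¬ Strict r y x ∧ β x y)

theorem resolves_lexOrder {r β : V → V → Prop} (total : ∀ x y, r x y ∨ r y x)
    (trans : ∀ x y z, r x y → r y z → r x z) (hβ : IsStrictTotalOrder V β) :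
    Resolves (lexOrder r β) r := by
  have irrefl : ∀ x, ¬ β x x := irrefl_of β
  have tr : ∀ x y z, β x y → β y z → β x z := fun x y z => trans_of β
  have tri : ∀ x y, β x y ∨ x = y ∨ β y x := trichotomous_of β
  refine ⟨{ irrefl := ?_, trans := ?_, trichotomous := ?_ }, fun x y h => Or.inl h⟩
  · simp only [lexOrder, Strict]; grind
  · simp only [lexOrder, Strict]; grind
  · simp only [lexOrder, Strict]; grind

/-- Every `α` must contain the strict pairs of `r`, so those inverted by `β` are unavoidable;
breaking the ties of `r` as `β` does creates no further inversion. -/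
theorem iInf_kendallTau [Finite V] {r β : V → V → Prop} (total : ∀ x y, r x y ∨ r y x)
    (trans : ∀ x y z, r x y → r y z → r x z) (hβ : IsStrictTotalOrder V β) :
    (⨅ α : {α : V → V → Prop // Resolves α r}, kendallTau α.1 β) =
      {p : V × V | Strict r p.1 p.2 ∧ β p.2 p.1}.ncard := by
  have hL := resolves_lexOrder total trans hβ
  have : Nonempty {α : V → V → Prop // Resolves α r} := ⟨⟨_, hL⟩⟩
  apply le_antisymm
  · refine (ciInf_le (OrderBot.bddBelow _) ⟨_, hL⟩).trans ?_
    refine Set.ncard_le_ncard ?_ (Set.toFinite _)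
    rintro ⟨x, y⟩ ⟨h | h, h'⟩
    · exact ⟨h, h'⟩
    · exact absurd (_root_.trans h.2 h') (irrefl_of β x)
  · refine le_ciInf fun α => Set.ncard_le_ncard ?_ (Set.toFinite _)
    rintro ⟨x, y⟩ ⟨h, h'⟩
    exact ⟨α.2.2 _ _ h, h'⟩

/-- A resolution of `s` can invert a strict pair of `r` only if `s` weakly inverts it, and breaking
the ties of `s` against `r` inverts all of these at once. -/
theorem directedTau_eq_ncard [Finite V] {r s : V → V → Prop} (r_total : ∀ x y, r x y ∨ r y x)
    (r_trans : ∀ x y z, r x y → r y z → r x z) (s_total : ∀ x y, s x y ∨ s y x)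
    (s_trans : ∀ x y z, s x y → s y z → s x z) :
    directedTau r s = {p : V × V | Strict r p.1 p.2 ∧ s p.2 p.1}.ncard := by
  have hW : IsStrictTotalOrder V (WellOrderingRel (α := V)) := inferInstance
  -- A linear order resolving the reverse of `r`; it serves as the tie-breaker for `s`, and an
  -- arbitrary well-order settles what is tied in `r` as well.
  have h₁ := resolves_lexOrder (r := fun x y => r y x) (fun x y => r_total y x)
    (fun x y z h h' => r_trans z y x h' h) hW
  have h₂ := resolves_lexOrder s_total s_trans h₁.1
  have : Nonempty {β : V → V → Prop // Resolves β s} := ⟨⟨_, h₂⟩⟩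
  have le : ∀ β : {β : V → V → Prop // Resolves β s},
      (⨅ α : {α : V → V → Prop // Resolves α r}, kendallTau α.1 β.1) ≤
        {p : V × V | Strict r p.1 p.2 ∧ s p.2 p.1}.ncard := fun β => by
    rw [iInf_kendallTau r_total r_trans β.2.1]
    refine Set.ncard_le_ncard ?_ (Set.toFinite _)
    rintro ⟨x, y⟩ ⟨h, h'⟩
    refine ⟨h, ?_⟩
    by_contra hs
    have := β.2.1
    have h'' := β.2.2 x y ⟨(s_total x y).resolve_right hs, hs⟩
    exact irrefl_of β.1 x (trans_of β.1 h'' h')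
  refine le_antisymm (ciSup_le le) ?_
  refine le_trans ?_ (le_ciSup ⟨_, Set.forall_mem_range.2 le⟩ ⟨_, h₂⟩)
  rw [iInf_kendallTau r_total r_trans h₂.1]
  refine Set.ncard_le_ncard ?_ (Set.toFinite _)
  rintro ⟨x, y⟩ ⟨h, h'⟩
  refine ⟨h, ?_⟩
  simp only [lexOrder, Strict] at h ⊢
  grind

open Classical in
theorem directedTauOn_eq_sum (S : Finset V) {r s : V → V → Prop}
    (r_total : ∀ x ∈ S, ∀ y ∈ S, r x y ∨ r y x)
    (r_trans : ∀ x ∈ S, ∀ y ∈ S, ∀ z ∈ S, r x y → r y z → r x z)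
    (s_total : ∀ x ∈ S, ∀ y ∈ S, s x y ∨ s y x)
    (s_trans : ∀ x ∈ S, ∀ y ∈ S, ∀ z ∈ S, s x y → s y z → s x z) :
    directedTauOn S r s = ∑ x ∈ S, #{y ∈ S | Strict r x y ∧ s y x} := by
  rw [directedTauOn, directedTau_eq_ncard (V := S) (fun x y => r_total x x.2 y y.2)
    (fun x y z => r_trans x x.2 y y.2 z z.2) (fun x y => s_total x x.2 y y.2)
    (fun x y z => s_trans x x.2 y y.2 z z.2)]
  have : Set.InjOn (fun p : S × S => ((p.1 : V), (p.2 : V)))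
      {p : S × S | Strict (fun x y : S => r x y) p.1 p.2 ∧ s p.2 p.1} := by
    rintro ⟨⟨a, ha⟩, ⟨b, hb⟩⟩ _ ⟨⟨c, hc⟩, ⟨d, hd⟩⟩ _ h
    simpa using h
  rw [← this.ncard_image]
  have : ((fun p : S × S => ((p.1 : V), (p.2 : V))) ''
      {p : S × S | Strict (fun x y : S => r x y) p.1 p.2 ∧ s p.2 p.1}) =
      ({p ∈ S ×ˢ S | Strict r p.1 p.2 ∧ s p.2 p.1} : Finset (V × V)) := by
    ext ⟨a, b⟩
    simp [Strict]
    grind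
  rw [this, Set.ncard_coe_finset, card_filter, sum_product]
  exact sum_congr rfl fun x _ => (card_filter _ _).symm

end Distance

/-! ### Distances as sums of weights, and the deviations that matter -/

namespace Game

variable {n : ℕ} (G : Game n)

open Classical in
/-- The distance is additively separable. -/
theorem delta_eq_sum (i : Fin n) (C : Finset (Fin n)) :
    G.delta i C = ∑ j ∈ G.friends i \ C, (1 + #{k ∈ G.friends i | Strict (G.pref i) j k}) +
      ∑ j ∈ G.enemies i ∩ C, (1 + #{k ∈ G.enemies i | Strict (G.pref i) k j}) := by
  have hF := G.not_mem_friends i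
  have hE := G.not_mem_enemies i
  have ft := G.friends_total i
  have fr := G.friends_trans i
  have et := G.enemies_total i
  have er := G.enemies_trans i
  rw [delta]
  congr 1
  · rw [directedTauOn_eq_sum, sum_insert hF]
    -- The player stands last among its friends in its own ballot, so it is strictly above nobody.
    · have h₀ : #{y ∈ insert i (G.friends i) | Strict (G.prefPlus i) i y ∧ G.coalPlus i C y i}
          = 0 := by
        simp only [card_eq_zero, filter_eq_empty_iff, Strict, prefPlus, coalPlus, ballot, rev]
        grind
      rw [h₀, zero_add]
      -- Friends inside `C` keep their order and stay ahead of all others, so they contribute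
      -- nothing.
      rw [← sum_subset (sdiff_subset : G.friends i \ C ⊆ G.friends i)]
      · refine sum_congr rfl fun j hj => ?_
        -- The summand `1` is `i` itself, now ahead of the missing friend. Every friend strictly
        -- below the missing one also overtakes it, either as a member of `C` or by the reversal.
        rw [filter_insert, if_pos, card_insert_of_notMem, add_comm]
        · congr 2
          ext y
          simp only [Strict, prefPlus, coalPlus, ballot, rev]
          grind
        · grind
        · simp only [Strict, prefPlus, coalPlus, ballot, rev]
          grind
      · intro j hj hj'
        simp only [card_eq_zero, Strict, prefPlus, coalPlus, ballot, rev]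
        grind
    · simp only [prefPlus, ballot]; grind
    · simp only [prefPlus, ballot]; grind
    · simp only [coalPlus, ballot, rev]; grind
    · simp only [coalPlus, ballot, rev]; grind
  · rw [directedTauOn_eq_sum]
    · simp only [card_filter _ (insert i (G.enemies i))]
      -- For enemies each pair is charged to its less preferred element, so the order of summation
      -- is exchanged.
      rw [sum_comm]
      simp only [← card_filter]
      rw [sum_insert hE]
      have h₀ : #{x ∈ insert i (G.enemies i) | Strict (G.prefMinus i) x i ∧
          G.coalMinus i C i x} = 0 := by
        simp only [card_eq_zero, filter_eq_empty_iff, Strict, prefMinus, coalMinus, ballot, rev]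
        grind
      rw [h₀, zero_add]
      rw [← sum_subset (inter_subset_left : G.enemies i ∩ C ⊆ G.enemies i)]
      · refine sum_congr rfl fun j hj => ?_
        rw [filter_insert, if_pos, card_insert_of_notMem, add_comm]
        · congr 2
          ext y
          simp only [Strict, prefMinus, coalMinus, ballot, rev]
          grind
        · grind
        · simp only [Strict, prefMinus, coalMinus, ballot, rev]
          grind
      · intro j hj hj'
        simp only [card_eq_zero, Strict, prefMinus, coalMinus, ballot, rev]
        grind
    · simp only [prefMinus, ballot]; grind
    · simp only [prefMinus, ballot]; grind
    · simp only [coalMinus, ballot, rev]; grind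
    · simp only [coalMinus, ballot, rev]; grind

theorem delta_insert_self (i : Fin n) (C : Finset (Fin n)) :
    G.delta i (insert i C) = G.delta i C := by
  have hF := G.not_mem_friends i
  have hE := G.not_mem_enemies i
  rw [delta_eq_sum, delta_eq_sum, sdiff_insert_of_notMem hF, inter_insert_of_notMem hE]

theorem delta_eq_delta_empty {i : Fin n} {C : Finset (Fin n)} (h : ∀ j ∈ G.known i, j ∉ C) :
    G.delta i C = G.delta i ∅ := by
  simp only [known, mem_union] at h
  rw [delta_eq_sum, delta_eq_sum, sdiff_empty, inter_empty, sdiff_eq_self_of_disjoint,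
    disjoint_iff_inter_eq_empty.1]
  · exact disjoint_left.2 fun j hj => h j (Or.inr hj)
  · exact disjoint_left.2 fun j hj => h j (Or.inl hj)

-- Losing a friend adds a summand that is at least `1`, while losing anyone else can only remove
-- summands.
open Classical in
theorem delta_erase_le_iff {i j : Fin n} {C : Finset (Fin n)} (h : j ∈ C) :
    G.delta i (C.erase j) ≤ G.delta i C ↔ j ∉ G.friends i := by
  have hd := disjoint_left.1 (G.disjoint i)
  rw [delta_eq_sum, delta_eq_sum]
  by_cases hF : j ∈ G.friends i
  · have h₁ : G.friends i \ C.erase j = insert j (G.friends i \ C) := by grind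
    have h₂ : G.enemies i ∩ C.erase j = G.enemies i ∩ C := by grind
    rw [h₁, h₂, sum_insert (by grind)]
    simp only [hF, not_true, iff_false]
    omega
  · have h₁ : G.friends i \ C.erase j = G.friends i \ C := by grind
    have h₂ : G.enemies i ∩ C.erase j ⊆ G.enemies i ∩ C := by grind
    simp only [hF, not_false_iff, iff_true, h₁]
    exact Nat.add_le_add_left (sum_le_sum_of_subset h₂) _

-- Gaining an enemy adds a summand that is at least `1`, while gaining anyone else can only remove
-- summands.
open Classical in
theorem delta_insert_le_iff {i j : Fin n} {C : Finset (Fin n)} (h : j ∉ C) :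
    G.delta i (insert j C) ≤ G.delta i C ↔ j ∉ G.enemies i := by
  have hd := disjoint_left.1 (G.disjoint i)
  rw [delta_eq_sum, delta_eq_sum]
  by_cases hE : j ∈ G.enemies i
  · have h₁ : G.enemies i ∩ insert j C = insert j (G.enemies i ∩ C) := by grind
    have h₂ : G.friends i \ insert j C = G.friends i \ C := by grind
    rw [h₁, h₂, sum_insert (by grind)]
    simp only [hE, not_true, iff_false]
    omega
  · have h₁ : G.enemies i ∩ insert j C = G.enemies i ∩ C := by grind
    have h₂ : G.friends i \ insert j C ⊆ G.friends i \ C := by grind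
    simp only [hE, not_false_iff, iff_true, h₁]
    exact Nat.add_le_add_right (sum_le_sum_of_subset h₂) _

theorem welcome_iff {i : Fin n} {C : Finset (Fin n)} (h : i ∉ C) :
    G.Welcome i C ↔ ∀ j ∈ C, i ∉ G.enemies j :=
  forall₂_congr fun _ _ => G.delta_insert_le_iff h

theorem notBound_iff {Γ : CoalitionStructure n} {i : Fin n} :
    G.NotBound Γ i ↔ ∀ j ∈ Γ.part i, i ∉ G.friends j := by
  have h := Γ.mem_part (mem_univ i)
  have h' : G.NotBound Γ i ↔ ∀ j ∈ (Γ.part i).erase i, i ∉ G.friends j :=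
    forall₂_congr fun _ _ => G.delta_erase_le_iff h
  have := G.not_mem_friends i
  grind

/-- No player wants to deviate, where only deviations that are welcome (if `w`) and not bound
(if `b`) are admitted. -/
def StableWith (w b : Prop) (Γ : CoalitionStructure n) : Prop :=
  ∀ i C, ¬ (G.Deviation Γ i C ∧ (w → G.Welcome i C) ∧ (b → G.NotBound Γ i))

/-- Only the empty coalition and the coalitions of known players matter. -/
theorem stableWith_iff {w b : Prop} {Γ : CoalitionStructure n} :
    G.StableWith w b Γ ↔ ∀ i, ∀ C, (C = ∅ ∨ ∃ j ∈ G.known i, C = Γ.part j) →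
      ¬ (G.delta i C < G.delta i (Γ.part i) ∧ ¬ (w ∧ ∃ j ∈ C, i ∈ G.enemies j) ∧
        ¬ (b ∧ ∃ j ∈ Γ.part i, i ∈ G.friends j)) := by
  have pref : ∀ i C, G.Prefers i (insert i C) (Γ.part i) ↔ G.delta i C < G.delta i (Γ.part i) := by
    intro i C
    rw [Prefers, WeaklyPrefers, WeaklyPrefers, delta_insert_self]
    omega
  -- A coalition of `Γ` containing `i` is the current one and cannot be strictly better; this
  -- supplies the hypothesis `i ∉ C` of `welcome_iff`.
  have key : ∀ i C, (C ∈ Γ.parts ∨ C = ∅) → G.delta i C < G.delta i (Γ.part i) → i ∉ C := by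
    intro i C hC h hi
    rcases hC with hC | rfl
    · rw [Γ.part_eq_of_mem hC hi] at h
      exact h.false
    · simp at hi
  simp only [StableWith, Deviation, pref, notBound_iff]
  constructor
  · rintro h i C hC ⟨h₁, h₂, h₃⟩
    have hC' : C ∈ Γ.parts ∨ C = ∅ := by
      rcases hC with rfl | ⟨j, -, rfl⟩
      · exact Or.inr rfl
      · exact Or.inl (Γ.part_mem.2 (mem_univ j))
    refine h i C ⟨⟨hC', h₁⟩, ?_, ?_⟩
    · rw [welcome_iff _ (key i C hC' h₁)]
      grind
    · grind
  · rintro h i C ⟨⟨hC, h₁⟩, h₂, h₃⟩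
    rw [welcome_iff _ (key i C hC h₁)] at h₂
    by_cases hk : C = ∅ ∨ ∃ j ∈ G.known i, C = Γ.part j
    · exact h i C hk ⟨h₁, by grind, by grind⟩
    · push Not at hk
      -- A target without known players is replaced by the empty coalition, at the same distance and
      -- with nobody to object.
      refine h i ∅ (Or.inl rfl) ⟨?_, by simp, by grind⟩
      rwa [← G.delta_eq_delta_empty (C := C)]
      intro j hj hjC
      exact hk.2 j hj (Γ.part_eq_of_mem (hC.resolve_right hk.1.ne_empty) hjC).symm

theorem nashStable_iff {Γ : CoalitionStructure n} :
    G.NashStable Γ ↔ G.StableWith False False Γ := by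
  simp [NashStable, StableWith]

theorem individuallyStable_iff {Γ : CoalitionStructure n} :
    G.IndividuallyStable Γ ↔ G.StableWith True False Γ := by
  simp [IndividuallyStable, StableWith]

theorem contractuallyIndividuallyStable_iff {Γ : CoalitionStructure n} :
    G.ContractuallyIndividuallyStable Γ ↔ G.StableWith True True Γ := by
  simp [ContractuallyIndividuallyStable, StableWith]

end Game

/-! ### Rules for bounding the steps of a run -/

namespace State

variable (σ : State)

@[simp] theorem setReg_reg (r v r' : ℕ) :
    (σ.setReg r v).reg r' = if r' = r then v else σ.reg r' := Function.update_apply ..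

@[simp] theorem setReg_arr (r v : ℕ) : (σ.setReg r v).arr = σ.arr := rfl

@[simp] theorem setArr_reg (a x v : ℕ) : (σ.setArr a x v).reg = σ.reg := rfl

theorem setArr_arr (a x v a' : ℕ) :
    (σ.setArr a x v).arr a' = if a' = a then Function.update (σ.arr a) x v else σ.arr a' :=
  Function.update_apply ..

end State

/-- The program `p` started in `σ` halts within `T` steps in a state that satisfies `Q`. -/
def Runs (W : ℕ) (p : Prog) (T : ℕ) (σ : State) (Q : State → Prop) : Prop :=
  ∃ t σ', Exec W p σ t σ' ∧ t ≤ T ∧ Q σ'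

namespace Runs

variable {W T T' : ℕ} {σ : State} {p q : Prog} {Q Q' : State → Prop} {b : Expr}

theorem mono (h : Runs W p T σ Q) (hT : T ≤ T') (hQ : ∀ σ, Q σ → Q' σ) : Runs W p T' σ Q' := by
  obtain ⟨t, σ', h₁, h₂, h₃⟩ := h
  exact ⟨t, σ', h₁, h₂.trans hT, hQ _ h₃⟩

theorem skip (hT : 1 ≤ T) (hQ : Q σ) : Runs W .skip T σ Q := ⟨1, σ, .skip σ, hT, hQ⟩

theorem assign {r : ℕ} {e : Expr} (he : e.Fits W σ) (hT : e.cost + 1 ≤ T)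
    (hQ : Q (σ.setReg r (e.eval σ))) : Runs W (.assign r e) T σ Q :=
  ⟨_, _, .assign σ r e he, hT, hQ⟩

theorem store {a : ℕ} {x e : Expr} (hx : x.Fits W σ) (he : e.Fits W σ)
    (hT : x.cost + e.cost + 1 ≤ T) (hQ : Q (σ.setArr a (x.eval σ) (e.eval σ))) :
    Runs W (.store a x e) T σ Q :=
  ⟨_, _, .store σ a x e hx he, hT, hQ⟩

theorem seq (T₁ T₂ : ℕ) (hT : T₁ + T₂ ≤ T) (h : Runs W p T₁ σ fun σ' => Runs W q T₂ σ' Q) :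
    Runs W (.seq p q) T σ Q := by
  obtain ⟨t, σ₁, h₁, h₂, u, σ₂, h₃, h₄, h₅⟩ := h
  exact ⟨_, _, .seq h₁ h₃, by omega, h₅⟩

theorem cond (T₁ : ℕ) (hf : b.Fits W σ) (hT : b.cost + 1 + T₁ ≤ T)
    (h₁ : b.eval σ ≠ 0 → Runs W p T₁ σ Q) (h₂ : b.eval σ = 0 → Runs W q T₁ σ Q) :
    Runs W (.cond b p q) T σ Q := by
  by_cases hb : b.eval σ = 0
  · obtain ⟨t, σ', h₁, h₂, h₃⟩ := h₂ hb
    exact ⟨_, _, .cond_false hf hb h₁, by omega, h₃⟩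
  · obtain ⟨t, σ', h₁, h₂, h₃⟩ := h₁ hb
    exact ⟨_, _, .cond_true hf hb h₁, by omega, h₃⟩

end Runs

namespace Prog

/-- `while r < hi do p; r := r + 1`. -/
def upTo (r : ℕ) (hi : Expr) (p : Prog) : Prog :=
  .loop (.lt (.reg r) hi) (.seq p (.assign r (.plus (.reg r) (.lit 1))))

end Prog

/-- The rule for loops with a counter: `I k` is the invariant when the counter is `k`. -/
theorem Runs.upTo {W r lo H D T T' : ℕ} {hi : Expr} {p : Prog} {σ : State} {I : ℕ → State → Prop}
    (hW : 1 < W) (hH : H < W) (hlo : lo ≤ H) (hD : H - lo ≤ D)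
    (hI : ∀ k σ, I k σ → σ.reg r = k ∧ hi.Fits W σ ∧ hi.eval σ = H)
    (hT : (D + 1) * (T + hi.cost + 7) ≤ T')
    (body : ∀ k σ, lo ≤ k → k < H → I k σ → Runs W p T σ fun σ' =>
      σ'.reg r = k ∧ I (k + 1) (σ'.setReg r (k + 1)))
    (h : I lo σ) : Runs W (.upTo r hi p) T' σ (I H) := by
  -- The `7` consists of `3` for the test beyond the cost of `hi` and `4` for the increment. The
  -- extra factor `+ 1` pays for the final, failing test.
  refine Runs.mono (T := (H - lo + 1) * (T + hi.cost + 7)) ?_ ?_ fun _ h => h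
  · clear hT hD
    obtain ⟨m, rfl⟩ := Nat.exists_eq_add_of_le hlo
    clear hlo
    induction m generalizing lo σ with
    | zero =>
      obtain ⟨h₁, h₂, h₃⟩ := hI _ _ h
      refine ⟨_, _, .loop_false ⟨?_, h₂, hW⟩ ?_, ?_, h⟩
      · simp only [Expr.Fits]; omega
      · simp [Expr.eval, h₁, h₃]
      · simp [Expr.cost]; omega
    | succ m ih =>
      obtain ⟨h₁, h₂, h₃⟩ := hI _ _ h
      obtain ⟨t, σ₁, e₁, ht, hr, hI₁⟩ := body lo σ le_rfl (by omega) h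
      obtain ⟨u, σ₂, e₂, hu, hI₂⟩ := ih hI₁ (by omega)
        (fun k σ h => by have := hI k σ h; exact ⟨this.1, this.2.1, by omega⟩)
        (fun k σ hk hk' => body k σ (by omega) (by omega))
      refine ⟨_, σ₂, .loop_true (u := u) ⟨?_, h₂, hW⟩ ?_ (.seq e₁ (.assign _ _ _ ?_)) ?_, ?_, ?_⟩
      · simp only [Expr.Fits]; omega
      · simp [Expr.eval, h₁, h₃]
      · simp only [Expr.Fits, Expr.eval]; omega
      · simpa [Expr.eval, hr, Prog.upTo] using e₂
      · have h₄ : lo + (m + 1) - lo = m + 1 := by omega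
        have h₅ : lo + 1 + m - (lo + 1) = m := by omega
        rw [h₅] at hu
        rw [h₄, add_mul _ 1]
        simp only [Expr.cost]
        omega
      · convert hI₂ using 1
        omega
  · exact le_trans (Nat.mul_le_mul_right _ (by omega)) hT

/-- `σ'` agrees with `σ` on all arrays and on the registers outside `R`. -/
structure State.AgreesOff (R : Set ℕ) (σ σ' : State) : Prop where
  arr : σ'.arr = σ.arr
  reg : ∀ r ∉ R, σ'.reg r = σ.reg r

namespace State.AgreesOff

theorem refl (R : Set ℕ) (σ : State) : AgreesOff R σ σ := ⟨rfl, fun _ _ => rfl⟩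

theorem trans {R : Set ℕ} {σ₁ σ₂ σ₃ : State} (h : AgreesOff R σ₁ σ₂) (h' : AgreesOff R σ₂ σ₃) :
    AgreesOff R σ₁ σ₃ :=
  ⟨h'.arr.trans h.arr, fun r hr => (h'.reg r hr).trans (h.reg r hr)⟩

theorem mono {R R' : Set ℕ} {σ σ' : State} (h : AgreesOff R σ σ') (hR : R ⊆ R') :
    AgreesOff R' σ σ' :=
  ⟨h.arr, fun r hr => h.reg r fun h => hr (hR h)⟩

theorem setReg {R : Set ℕ} {σ σ' : State} (h : AgreesOff R σ σ') {r v : ℕ} (hr : r ∈ R) :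
    AgreesOff R σ (σ'.setReg r v) :=
  ⟨h.arr, fun r' hr' => by
    rw [State.setReg_reg, if_neg (by rintro rfl; exact hr' hr), h.reg r' hr']⟩

end State.AgreesOff

/-- `p` adds `v` to the register `s` within `T` steps and otherwise changes only registers
in `R`. -/
def Adds (W : ℕ) (p : Prog) (T : ℕ) (R : Set ℕ) (s v : ℕ) (σ : State) : Prop :=
  Runs W p T σ fun σ' => σ'.reg s = σ.reg s + v ∧ σ.AgreesOff (insert s R) σ'

/-- A loop whose body adds `f k` to `s` adds `∑ k, f k`. -/
theorem Adds.upTo {W r s lo H D T T' : ℕ} {hi : Expr} {p : Prog} {σ : State} {R : Set ℕ}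
    {f : ℕ → ℕ} (hW : 1 < W) (hH : H < W) (hlo : lo ≤ H) (hD : H - lo ≤ D) (hr : r ∉ R)
    (hrs : r ≠ s) (hreg : σ.reg r = lo)
    (hhi : ∀ σ', σ.AgreesOff (insert s (insert r R)) σ' → hi.Fits W σ' ∧ hi.eval σ' = H)
    (hT : (D + 1) * (T + hi.cost + 7) ≤ T')
    (body : ∀ k σ', lo ≤ k → k < H → σ'.reg r = k →
      σ'.reg s + f k ≤ σ.reg s + ∑ j ∈ Ico lo H, f j → σ.AgreesOff (insert s (insert r R)) σ' →
      Adds W p T R s (f k) σ') :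
    Adds W (.upTo r hi p) T' (insert r R) s (∑ k ∈ Ico lo H, f k) σ := by
  have := Runs.upTo (W := W) (r := r) (hi := hi) (p := p) (σ := σ) (T := T) (T' := T') (D := D)
    (lo := lo) (H := H)
    (I := fun k σ' => σ'.reg r = k ∧ σ'.reg s = σ.reg s + ∑ j ∈ Ico lo k, f j ∧
      σ.AgreesOff (insert s (insert r R)) σ') hW hH hlo hD
    (fun k σ' h => ⟨h.1, hhi σ' h.2.2⟩) hT ?_ ⟨hreg, by simp, .refl _ _⟩
  · exact this.mono le_rfl fun σ' h => h.2
  · rintro k σ' h₁ h₂ ⟨h₃, h₄, h₅⟩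
    -- Partial sums stay below the total, so excluding overflow of the total suffices for every
    -- iteration.
    have h₆ : σ'.reg s + f k ≤ σ.reg s + ∑ j ∈ Ico lo H, f j := by
      rw [h₄, add_assoc, ← sum_Ico_succ_top h₁]
      exact Nat.add_le_add_left (sum_le_sum_of_subset (Ico_subset_Ico_right h₂)) _
    refine (body k σ' h₁ h₂ h₃ h₆ h₅).mono le_rfl fun σ'' h => ?_
    refine ⟨?_, by simp, ?_, ?_⟩
    · rw [h.2.reg r (by simp [hr, hrs]), h₃]
    · rw [State.setReg_reg, if_neg hrs.symm]
      rw [h.1, h₄, sum_Ico_succ_top h₁, add_assoc]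
    · exact (h₅.trans (h.2.mono (Set.insert_subset_insert (Set.subset_insert _ _)))).setReg
        (by simp)

/-! ## The quantities that the programs compute, in terms of the arrays -/

section Values

variable (A : ℕ → ℕ → ℕ)

/-- Whether the known player at position `e` counts against the one at position `f`: a friend
against the friends ranked below it, an enemy against the enemies ranked above it. -/
def pairVal (e f : ℕ) : ℕ :=
  if A 2 e = A 2 f then
    (if A 2 e ≠ 0 then (if A 3 e < A 3 f then 1 else 0) else (if A 3 f < A 3 e then 1 else 0))
  else 0

/-- The leading `1` accounts for the pair formed with the player `i` itself. -/
def weightVal (i e : ℕ) : ℕ := 1 + ∑ f ∈ Ico (A 0 i) (A 0 (i + 1)), pairVal A e f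

/-- The distance between the preferences of `i` and the coalition with label `l`. -/
def deltaVal (i l : ℕ) : ℕ :=
  ∑ e ∈ Ico (A 0 i) (A 0 (i + 1)),
    -- The sign agrees with membership for a friend inside or an enemy outside, which are the cases
    -- without cost.
    if A 2 e = (if A 4 (A 1 e) = l then 1 else 0) then 0 else weightVal A i e

/-- Whether `i` has an admissible deviation to the coalition with label `l`. -/
def checkVal (i l : ℕ) : ℕ :=
  if deltaVal A i l < deltaVal A i (A 4 i) ∧ A 6 (A 5 i + l) = 0 ∧ A 7 i = 0 then 1 else 0

/-- Labels of players are below `n`, so the label `n` stands for the empty coalition. A coalition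
met several times is counted several times, which is harmless since only the vanishing of the count
matters. -/
def playerVal (n i : ℕ) : ℕ :=
  checkVal A i n + ∑ c ∈ Ico (A 0 i) (A 0 (i + 1)), checkVal A i (A 4 (A 1 c))

/-- The bounds on the input that the word size and the running time depend on. -/
structure Bounds (n d W : ℕ) : Prop where
  mono : ∀ i < n, A 0 i ≤ A 0 (i + 1)
  length_le : ∀ i < n, A 0 (i + 1) ≤ A 0 i + d
  offset_lt : ∀ i ≤ n, A 0 i < W
  known_lt : ∀ i < n, ∀ e ∈ Set.Ico (A 0 i) (A 0 (i + 1)), A 1 e < n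
  sign_lt : ∀ e, A 2 e < W
  rank_lt : ∀ e, A 3 e < W
  label_lt : ∀ i < n, A 4 i < n
  row_lt : ∀ i < n, ∀ l ≤ n, A 5 i + l < W
  table_lt : ∀ x, A 6 x < W
  bound_lt : ∀ x, A 7 x < W
  size_lt : n + 1 < W
  value_lt : d * (d + 1) < W
  count_lt : n * (d + 1) < W

variable {A}

theorem pairVal_le (e f : ℕ) : pairVal A e f ≤ 1 := by
  unfold pairVal
  split_ifs <;> omega

theorem weightVal_le {i d : ℕ} (h : A 0 (i + 1) ≤ A 0 i + d) (e : ℕ) :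
    weightVal A i e ≤ d + 1 := by
  have := sum_le_card_nsmul (Ico (A 0 i) (A 0 (i + 1))) (fun f => pairVal A e f) 1
    fun f _ => pairVal_le e f
  simp only [Nat.card_Ico, smul_eq_mul, mul_one] at this
  rw [weightVal]
  omega

theorem deltaVal_le {i d : ℕ} (h : A 0 (i + 1) ≤ A 0 i + d) (l : ℕ) :
    deltaVal A i l ≤ d * (d + 1) := by
  refine (sum_le_card_nsmul _ _ (d + 1) fun e _ => ?_).trans ?_
  · have := weightVal_le h e
    split_ifs <;> omega
  · rw [smul_eq_mul, Nat.card_Ico]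
    exact Nat.mul_le_mul_right _ (by omega)

theorem checkVal_le (i l : ℕ) : checkVal A i l ≤ 1 := by
  unfold checkVal
  split_ifs <;> omega

theorem playerVal_le {i d : ℕ} (n : ℕ) (h : A 0 (i + 1) ≤ A 0 i + d) :
    playerVal A n i ≤ d + 1 := by
  have := sum_le_card_nsmul (Ico (A 0 i) (A 0 (i + 1))) (fun c => checkVal A i (A 4 (A 1 c))) 1
    fun c _ => checkVal_le i _
  have := checkVal_le (A := A) i n
  simp only [Nat.card_Ico, smul_eq_mul, mul_one] at *
  rw [playerVal]
  omega

end Values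

/-! ## The programs

Register 0 holds `n`, register 1 the current player, 2 the position of a known player whose
coalition is tried, 3 the label of a coalition, 4 and 5 the distances to the own and to the new
coalition, 6 and 7 positions in the list of the current player, and 8 the number of deviations. -/

namespace Prog

open FEN.Expr

/-- The end of the list of the current player. -/
def listEnd : Expr := get 0 (plus (reg 1) (lit 1))

def incr (s : ℕ) (e : Expr) : Prog := assign s (plus (reg s) e)

def addPair (s : ℕ) : Prog :=
  cond (eq (get 2 (reg 6)) (get 2 (reg 7)))
    (cond (get 2 (reg 6)) (incr s (lt (get 3 (reg 6)) (get 3 (reg 7))))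
      (incr s (lt (get 3 (reg 7)) (get 3 (reg 6))))) skip

def addWeight (s : ℕ) : Prog :=
  seq (incr s (lit 1)) (seq (assign 7 (get 0 (reg 1))) (upTo 7 listEnd (addPair s)))

def addDelta (s : ℕ) : Prog :=
  seq (assign 6 (get 0 (reg 1))) (upTo 6 listEnd
    (cond (eq (get 2 (reg 6)) (eq (get 4 (get 1 (reg 6))) (reg 3))) skip (addWeight s)))

def addCheck : Prog :=
  seq (assign 5 (lit 0)) (seq (addDelta 5)
    (cond (lt (reg 5) (reg 4))
      (cond (get 6 (plus (get 5 (reg 1)) (reg 3))) skip (cond (get 7 (reg 1)) skip (incr 8 (lit 1))))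
      skip))

def addPlayer : Prog :=
  seq (assign 3 (get 4 (reg 1))) (seq (assign 4 (lit 0)) (seq (addDelta 4)
    (seq (assign 3 (reg 0)) (seq addCheck (seq (assign 2 (get 0 (reg 1)))
      (upTo 2 listEnd (seq (assign 3 (get 4 (get 1 (reg 2)))) addCheck)))))))

/-- Sets up `arr 5 i = i * (n + 1)`. -/
def setRows : Prog :=
  -- The machine cannot multiply, so register 2 accumulates the row offsets. Rows have length `n +
  -- 1` to leave room for the label `n`.
  upTo 1 (reg 0) (seq (store 5 (reg 1) (reg 2)) (incr 2 (plus (reg 0) (lit 1))))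

/-- Writes `w` to the table `arr 6` for every enemy of a player `x`, at the label of `x`, and `b` to
`arr 7` for every friend of a player in the same coalition. -/
def setTables (w b : ℕ) : Prog :=
  seq (assign 1 (lit 0)) (upTo 1 (reg 0) (seq (assign 6 (get 0 (reg 1))) (upTo 6 listEnd
    (cond (get 2 (reg 6))
      (cond (eq (get 4 (reg 1)) (get 4 (get 1 (reg 6)))) (store 7 (get 1 (reg 6)) (lit b)) skip)
      (store 6 (plus (get 5 (get 1 (reg 6))) (get 4 (reg 1))) (lit w))))))

/-- Decides stability; only welcome deviations count if `w = 1`, only those of players who are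
not bound if `b = 1`. -/
def stability (w b : ℕ) : Prog :=
  seq setRows (seq (setTables w b) (seq (assign 1 (lit 0))
    (seq (upTo 1 (reg 0) addPlayer) (assign 0 (eq (reg 8) (lit 0))))))

end Prog

open Prog

/-! ### Cost and correctness of the counting loops -/

section Counting

variable {n d W : ℕ} {σ : State}

theorem adds_addPair (hB : Bounds σ.arr n d W) {s e f : ℕ} (h₆ : σ.reg 6 = e) (h₇ : σ.reg 7 = f)
    (he : e < W) (hf : f < W) (hv : σ.reg s + pairVal σ.arr e f < W) :
    Adds W (addPair s) 24 ∅ s (pairVal σ.arr e f) σ := by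
  have hs := hB.sign_lt
  have hr := hB.rank_lt
  have hW := hB.size_lt
  have h1 : 1 < W := by omega
  refine Runs.cond 17 ?_ ?_ (fun h => Runs.cond 10 ?_ ?_ (fun h' => Runs.assign ?_ ?_ ?_)
    (fun h' => Runs.assign ?_ ?_ ?_)) (fun h => Runs.skip ?_ ?_)
  all_goals simp only [Expr.cost, Expr.Fits, Expr.eval, h₆, h₇] at *
  · grind
  · omega
  · grind
  · omega
  · rw [pairVal] at hv; grind
  · omega
  · refine ⟨?_, (State.AgreesOff.refl _ _).setReg (by simp)⟩
    simp only [State.setReg_reg, if_true, pairVal]; grind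
  · rw [pairVal] at hv; grind
  · omega
  · refine ⟨?_, (State.AgreesOff.refl _ _).setReg (by simp)⟩
    simp only [State.setReg_reg, if_true, pairVal]; grind
  · omega
  · refine ⟨?_, .refl _ _⟩
    simp only [pairVal]; grind

theorem fits_listEnd (hB : Bounds σ.arr n d W) {i : ℕ} (h₁ : σ.reg 1 = i) (hi : i < n) :
    listEnd.Fits W σ ∧ listEnd.eval σ = σ.arr 0 (i + 1) := by
  have := hB.size_lt
  have := hB.offset_lt (i + 1) hi
  simp only [listEnd, Expr.Fits, Expr.eval, h₁, and_true]
  omega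

/-- The choices for `s` keep the accumulator apart from registers 1, 6 and 7, which the loop reads.
An iteration costs `35`: `24` for the body, `4` for `listEnd`, `7` for the loop. -/
theorem adds_addWeight (hB : Bounds σ.arr n d W) {s i e : ℕ} (h₁ : σ.reg 1 = i) (hi : i < n)
    (h₆ : σ.reg 6 = e) (he : e < W) (hs : s = 4 ∨ s = 5)
    (hv : σ.reg s + weightVal σ.arr i e < W) :
    Adds W (addWeight s) ((d + 1) * 35 + 10) {7} s (weightVal σ.arr i e) σ := by
  have hW := hB.size_lt
  have ho := hB.offset_lt i hi.le
  have ho' := hB.offset_lt (i + 1) hi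
  have s1 : s ≠ 1 := by omega
  have s6 : s ≠ 6 := by omega
  have s7 : s ≠ 7 := by omega
  rw [weightVal] at hv
  refine Runs.seq 4 ((d + 1) * 35 + 4) (by omega) (.assign ?_ ?_ ?_)
  · simp only [Expr.Fits, Expr.eval]; omega
  · simp [Expr.cost]
  refine Runs.seq 3 ((d + 1) * 35) (by omega) (.assign ?_ ?_ ?_)
  · simp [Expr.Fits, Expr.eval, s1.symm, h₁]; omega
  · simp [Expr.cost]
  simp only [Expr.eval]
  set τ := (σ.setReg s (σ.reg s + 1)).setReg 7 ((σ.setReg s (σ.reg s + 1)).arr 0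
    ((σ.setReg s (σ.reg s + 1)).reg 1)) with hτ
  have hag : σ.AgreesOff {s, 7} τ :=
    (((State.AgreesOff.refl _ _).setReg (by simp)).setReg (by simp))
  have hτs : τ.reg s = σ.reg s + 1 := by simp [hτ, s7]
  have key := Adds.upTo (W := W) (r := 7) (s := s) (lo := σ.arr 0 i) (H := σ.arr 0 (i + 1)) (D := d)
    (T := 24) (T' := (d + 1) * 35) (hi := listEnd) (p := addPair s) (σ := τ) (R := ∅)
    (f := pairVal σ.arr e) (by omega) ho' (hB.mono i hi) (by have := hB.length_le i hi; omega)
    (by simp) s7.symm (by simp [hτ, s1.symm, h₁]) ?_ ?_ ?_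
  · refine key.mono le_rfl fun σ' h => ⟨?_, hag.trans (h.2.mono (by simp))⟩
    rw [h.1, hτs, weightVal, add_assoc]
  · intro σ' h
    have ha := h.arr.trans hag.arr
    rw [← ha] at hB ⊢
    exact fits_listEnd hB ((h.reg 1 (by simp [s1.symm])).trans
      ((hag.reg 1 (by simp [s1.symm])).trans h₁)) hi
  · simp [listEnd, Expr.cost]
  · intro k σ' hk hk' h₇ hle h
    have ha := h.arr.trans hag.arr
    rw [← ha] at hB hle ho' hk' hv ⊢
    refine adds_addPair hB ((h.reg 6 (by simp [s6.symm])).trans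
      ((hag.reg 6 (by simp [s6.symm])).trans h₆)) h₇ he (by omega) (by omega)

theorem adds_addDelta (hB : Bounds σ.arr n d W) {s i l : ℕ} (h₁ : σ.reg 1 = i) (hi : i < n)
    (h₃ : σ.reg 3 = l) (hl : l ≤ n) (hs : s = 4 ∨ s = 5)
    (hv : σ.reg s + deltaVal σ.arr i l < W) :
    Adds W (addDelta s) ((d + 1) * ((d + 1) * 35 + 30) + 3) {6, 7} s (deltaVal σ.arr i l) σ := by
  have hW := hB.size_lt
  have ho := hB.offset_lt i hi.le
  have ho' := hB.offset_lt (i + 1) hi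
  have s1 : s ≠ 1 := by omega
  have s3 : s ≠ 3 := by omega
  have s6 : s ≠ 6 := by omega
  have s7 : s ≠ 7 := by omega
  rw [deltaVal] at hv
  refine Runs.seq 3 ((d + 1) * ((d + 1) * 35 + 30)) (by omega) (.assign ?_ ?_ ?_)
  · simp only [Expr.Fits, Expr.eval, h₁]; omega
  · simp [Expr.cost]
  simp only [Expr.eval, h₁]
  set τ := σ.setReg 6 (σ.arr 0 i) with hτ
  have hag : σ.AgreesOff {s, 6, 7} τ := (State.AgreesOff.refl _ _).setReg (by simp)
  have key := Adds.upTo (W := W) (r := 6) (s := s) (lo := σ.arr 0 i) (H := σ.arr 0 (i + 1)) (D := d)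
    (T := (d + 1) * 35 + 19) (T' := (d + 1) * ((d + 1) * 35 + 30)) (hi := listEnd)
    (p := .cond (.eq (.get 2 (.reg 6)) (.eq (.get 4 (.get 1 (.reg 6))) (.reg 3))) .skip
      (addWeight s)) (σ := τ) (R := {7})
    (f := fun e => if σ.arr 2 e = (if σ.arr 4 (σ.arr 1 e) = l then 1 else 0) then 0
      else weightVal σ.arr i e) (by omega) ho' (hB.mono i hi)
    (by have := hB.length_le i hi; omega) (by simp) s6.symm (by simp [hτ]) ?_ ?_ ?_
  · refine key.mono le_rfl fun σ' h => ⟨?_, hag.trans h.2⟩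
    rw [h.1, hτ, State.setReg_reg, if_neg s6]
    rfl
  · intro σ' h
    have ha := h.arr.trans hag.arr
    rw [← ha] at hB ⊢
    exact fits_listEnd hB ((h.reg 1 (by simp [s1.symm])).trans
      ((hag.reg 1 (by simp [s1.symm])).trans h₁)) hi
  · simp only [listEnd, Expr.cost]
    exact le_of_eq (by ring)
  · intro k σ' hk hk' h₆ hle h
    have ha := h.arr.trans hag.arr
    have hτs : τ.reg s = σ.reg s := by simp [hτ, s6]
    have h₁' := (h.reg 1 (by simp [s1.symm])).trans ((hag.reg 1 (by simp [s1.symm])).trans h₁)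
    have h₃' := (h.reg 3 (by simp [s3.symm])).trans ((hag.reg 3 (by simp [s3.symm])).trans h₃)
    have hkn := hB.known_lt i hi k ⟨hk, hk'⟩
    have hkl := hB.label_lt _ hkn
    have hks := hB.sign_lt k
    rw [← ha] at hB hle ho' hk' hv hkn hkl hks ⊢
    refine Runs.cond ((d + 1) * 35 + 10) ?_ ?_ (fun h => .skip (by omega) ⟨?_, .refl _ _⟩)
      (fun h => ?_)
    · simp only [Expr.Fits, Expr.eval, h₆, h₃']
      refine ⟨?_, ?_, ?_⟩ <;> omega
    · simp [Expr.cost]; omega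
    · simp only [Expr.eval, h₆, h₃'] at h
      rw [if_pos (by simpa using h), add_zero]
    · simp only [Expr.eval, h₆, h₃'] at h
      have hne : ¬ σ'.arr 2 k = (if σ'.arr 4 (σ'.arr 1 k) = l then 1 else 0) := by simpa using h
      rw [if_neg hne] at hle ⊢
      exact adds_addWeight hB h₁' hi h₆ (by omega) hs (by omega)

theorem adds_addCheck (hB : Bounds σ.arr n d W) {i l : ℕ} (h₁ : σ.reg 1 = i) (hi : i < n)
    (h₃ : σ.reg 3 = l) (hl : l ≤ n) (h₄ : σ.reg 4 = deltaVal σ.arr i (σ.arr 4 i))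
    (hv : σ.reg 8 + checkVal σ.arr i l < W) :
    Adds W addCheck ((d + 1) * ((d + 1) * 35 + 30) + 30) {5, 6, 7} 8 (checkVal σ.arr i l) σ := by
  have hW := hB.size_lt
  have hd := hB.value_lt
  have hdl := deltaVal_le (hB.length_le i hi) l
  have hdo := deltaVal_le (hB.length_le i hi) (σ.arr 4 i)
  have hrow := hB.row_lt i hi l hl
  -- The row offset alone must be a machine word too, since it is read before the label is added.
  have hrow' := hB.row_lt i hi 0 (by omega)
  have htab := hB.table_lt
  have hbd := hB.bound_lt
  refine Runs.seq 2 ((d + 1) * ((d + 1) * 35 + 30) + 28) (by omega) (.assign ?_ ?_ ?_)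
  · simp only [Expr.Fits]; omega
  · simp [Expr.cost]
  simp only [Expr.eval]
  have hag : σ.AgreesOff {5} (σ.setReg 5 0) := (State.AgreesOff.refl _ _).setReg (by simp)
  refine Runs.seq ((d + 1) * ((d + 1) * 35 + 30) + 3) 25 (by omega) ?_
  have key := adds_addDelta (σ := σ.setReg 5 0) (l := l) (s := 5) (i := i) hB h₁ hi h₃ hl
    (Or.inr rfl) (by simp; omega)
  refine key.mono le_rfl fun σ' h => ?_
  have hag' : σ.AgreesOff {5, 6, 7} σ' :=
    (hag.mono (by simp)).trans h.2
  have h₅ : σ'.reg 5 = deltaVal σ.arr i l := by simpa using h.1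
  have h₁' := (hag'.reg 1 (by simp)).trans h₁
  have h₃' := (hag'.reg 3 (by simp)).trans h₃
  have h₄' := (hag'.reg 4 (by simp)).trans h₄
  have h₈ := hag'.reg 8 (by simp)
  have ha := hag'.arr
  have hag₈ : σ.AgreesOff {8, 5, 6, 7} σ' := hag'.mono (by simp)
  refine Runs.cond 21 ?_ ?_ (fun h => Runs.cond 14 ?_ ?_ (fun h' => ?_)
    (fun h' => Runs.cond 10 ?_ ?_ (fun h'' => ?_) fun h'' => ?_)) (fun h => ?_)
  · simp only [Expr.Fits, h₅, h₄']; omega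
  · simp [Expr.cost]
  · simp only [Expr.Fits, Expr.eval, ha, h₁', h₃']
    exact ⟨⟨⟨by omega, by omega⟩, by omega, hrow⟩, htab _⟩
  · simp [Expr.cost]
  · simp only [Expr.eval, ha, h₁', h₃'] at h'
    refine .skip (by omega) ⟨?_, hag₈⟩
    rw [h₈, checkVal, if_neg (by tauto), add_zero]
  · simp only [Expr.Fits, Expr.eval, ha, h₁']
    exact ⟨by omega, hbd _⟩
  · simp [Expr.cost]
  · simp only [Expr.eval, ha, h₁'] at h''
    refine .skip (by omega) ⟨?_, hag₈⟩
    rw [h₈, checkVal, if_neg (by tauto), add_zero]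
  · simp only [Expr.eval, ha, h₁', h₃', h₄', h₅] at h h' h''
    have hc : checkVal σ.arr i l = 1 := by
      rw [checkVal, if_pos ⟨by simpa using h, h', h''⟩]
    rw [hc] at hv ⊢
    refine .assign ?_ ?_ ⟨?_, hag₈.setReg (by simp)⟩
    · simp only [Expr.Fits, Expr.eval, h₈]; omega
    · simp [Expr.cost]
    · simp [Expr.eval, h₈]
  · simp only [Expr.eval, h₄', h₅] at h
    refine .skip (by omega) ⟨?_, hag₈⟩
    rw [h₈, checkVal, if_neg, add_zero]
    rintro ⟨hlt, -⟩
    simp [hlt] at h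

/-- The number of steps spent on a player with at most `d` known players. -/
def playerTime (d : ℕ) : ℕ := (d + 3) * ((d + 1) * ((d + 1) * 35 + 30) + 50)

theorem adds_addPlayer (hB : Bounds σ.arr n d W) {i : ℕ} (h₀ : σ.reg 0 = n) (h₁ : σ.reg 1 = i)
    (hi : i < n) (hv : σ.reg 8 + playerVal σ.arr n i < W) :
    Adds W addPlayer (playerTime d) {2, 3, 4, 5, 6, 7} 8 (playerVal σ.arr n i) σ := by
  have hW := hB.size_lt
  have ho := hB.offset_lt i hi.le
  have ho' := hB.offset_lt (i + 1) hi
  have hd := hB.value_lt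
  have hli := hB.label_lt i hi
  have hdo := deltaVal_le (hB.length_le i hi) (σ.arr 4 i)
  set t := (d + 1) * ((d + 1) * 35 + 30) with ht
  rw [playerVal] at hv
  refine Runs.seq 3 (3 + (t + 3) + 2 + (t + 30) + 3 + (d + 1) * (t + 50)) ?_ (.assign ?_ ?_ ?_)
  · rw [playerTime, ← ht]
    -- Beyond the `d + 1` loop units, two units pay for the distance to the own coalition and for
    -- the check of the empty one.
    have : (d + 3) * (t + 50) = (d + 1) * (t + 50) + 2 * (t + 50) := by ring
    omega
  · simp only [Expr.Fits, Expr.eval, h₁]; omega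
  · simp [Expr.cost]
  refine Runs.seq 2 ((t + 3) + 2 + (t + 30) + 3 + (d + 1) * (t + 50)) (by omega) (.assign ?_ ?_ ?_)
  · simp only [Expr.Fits]; omega
  · simp [Expr.cost]
  simp only [Expr.eval, h₁]
  set τ := (σ.setReg 3 (σ.arr 4 i)).setReg 4 0 with hτ
  have hag : σ.AgreesOff {2, 3, 4, 5, 6, 7} τ :=
    ((State.AgreesOff.refl _ _).setReg (by simp)).setReg (by simp)
  refine Runs.seq (t + 3) (2 + (t + 30) + 3 + (d + 1) * (t + 50)) (by omega) ?_
  have key := adds_addDelta (σ := τ) (l := σ.arr 4 i) (s := 4) (i := i) hB h₁ hi (by simp [hτ])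
    hli.le (Or.inl rfl) (by simp [hτ]; omega)
  refine key.mono le_rfl fun σ₁ h => ?_
  clear key
  have hag₁ : σ.AgreesOff {2, 3, 4, 5, 6, 7} σ₁ :=
    hag.trans (h.2.mono (by intro; simp; omega))
  have e₄ : σ₁.reg 4 = deltaVal σ.arr i (σ.arr 4 i) := by simpa [hτ] using h.1
  have e₀ := (hag₁.reg 0 (by simp)).trans h₀
  clear_value τ
  clear h hag hτ
  -- Register 3 receives the label `n`, which no player bears: the check that follows concerns the
  -- empty coalition.
  refine Runs.seq 2 ((t + 30) + 3 + (d + 1) * (t + 50)) (by omega) (.assign ?_ ?_ ?_)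
  · simp only [Expr.Fits, e₀]; omega
  · simp [Expr.cost]
  simp only [Expr.eval, e₀]
  have hag₂ : σ.AgreesOff {2, 3, 4, 5, 6, 7} (σ₁.setReg 3 n) := hag₁.setReg (by simp)
  refine Runs.seq (t + 30) (3 + (d + 1) * (t + 50)) (by omega) ?_
  have ha₂ := hag₂.arr
  have key := adds_addCheck (σ := σ₁.setReg 3 n) (i := i) (l := n) (by rw [ha₂]; exact hB)
    ((hag₂.reg 1 (by simp)).trans h₁) hi (by simp) le_rfl
    (by rw [ha₂]; simpa using e₄) (by rw [ha₂, hag₂.reg 8 (by simp)]; omega)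
  refine key.mono le_rfl fun σ₃ h => ?_
  clear key
  rw [ha₂, hag₂.reg 8 (by simp)] at h
  have e₁ : σ₃.reg 1 = i := (h.2.reg 1 (by simp)).trans ((hag₂.reg 1 (by simp)).trans h₁)
  have e₄ : σ₃.reg 4 = deltaVal σ.arr i (σ.arr 4 i) := by
    rw [h.2.reg 4 (by simp)]
    simpa using e₄
  have hag₃ : σ.AgreesOff {8, 2, 3, 4, 5, 6, 7} σ₃ :=
    (hag₂.mono (by simp)).trans (h.2.mono (by intro; simp; omega))
  have ha₃ := hag₃.arr
  have e₈ := h.1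
  clear h ha₂ hag₂ hag₁
  refine Runs.seq 3 ((d + 1) * (t + 50)) (by omega) (.assign ?_ ?_ ?_)
  · simp only [Expr.Fits, Expr.eval, e₁, ha₃]; omega
  · simp [Expr.cost]
  simp only [Expr.eval, e₁, ha₃]
  have key := Adds.upTo (W := W) (r := 2) (s := 8) (lo := σ.arr 0 i) (H := σ.arr 0 (i + 1)) (D := d)
    (T := t + 35) (T' := (d + 1) * (t + 50)) (hi := listEnd)
    (p := .seq (.assign 3 (.get 4 (.get 1 (.reg 2)))) addCheck) (σ := σ₃.setReg 2 (σ.arr 0 i))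
    (R := {3, 5, 6, 7}) (f := fun c => checkVal σ.arr i (σ.arr 4 (σ.arr 1 c)))
    (by omega) ho' (hB.mono i hi)
    (by have := hB.length_le i hi; omega) (by simp) (by simp) (by simp) ?_ ?_ ?_
  · refine key.mono le_rfl fun σ' h => ⟨?_, (hag₃.setReg (by simp)).trans (h.2.mono ?_)⟩
    · rw [h.1, State.setReg_reg, if_neg (by simp), e₈, playerVal, add_assoc]
    · intro; simp; omega
  · intro σ' h
    have ha : σ'.arr = σ.arr := h.arr.trans ha₃
    rw [← ha] at hB ⊢
    exact fits_listEnd hB ((h.reg 1 (by simp)).trans (by simpa using e₁)) hi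
  · simp only [listEnd, Expr.cost]
    exact Nat.mul_le_mul_left _ (by omega)
  · intro k σ' hk hk' h₂ hle h
    have ha : σ'.arr = σ.arr := h.arr.trans ha₃
    have e₁' : σ'.reg 1 = i := (h.reg 1 (by simp)).trans (by simpa using e₁)
    have e₄' : σ'.reg 4 = deltaVal σ.arr i (σ.arr 4 i) :=
      (h.reg 4 (by simp)).trans (by simpa using e₄)
    have hkn := hB.known_lt i hi k ⟨hk, hk'⟩
    have hkl := hB.label_lt _ hkn
    simp only [State.setReg_reg] at hle
    refine Runs.seq 4 (t + 30) (by omega) (.assign ?_ ?_ ?_)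
    · simp only [Expr.Fits, Expr.eval, ha, h₂]; omega
    · simp [Expr.cost]
    simp only [Expr.eval, ha, h₂]
    have key := adds_addCheck (σ := σ'.setReg 3 (σ.arr 4 (σ.arr 1 k))) (i := i)
      (l := σ.arr 4 (σ.arr 1 k)) (by rw [State.setReg_arr, ha]; exact hB) (by simpa using e₁') hi
      (by simp) hkl.le (by rw [State.setReg_arr, ha]; simpa using e₄')
      (by rw [State.setReg_arr, ha]; simp at hle ⊢; omega)
    rw [State.setReg_arr, ha] at key
    refine key.mono le_rfl fun σ'' h' => ⟨by simpa using h'.1, ?_⟩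
    exact ((State.AgreesOff.refl _ _).setReg (by simp)).trans (h'.2.mono (by intro; simp; omega))

theorem adds_players (hB : Bounds σ.arr n d W) (h₀ : σ.reg 0 = n) (h₁ : σ.reg 1 = 0)
    (h₈ : σ.reg 8 = 0) :
    Adds W (upTo 1 (.reg 0) addPlayer) ((n + 1) * (playerTime d + 8)) {1, 2, 3, 4, 5, 6, 7} 8
      (∑ i ∈ range n, playerVal σ.arr n i) σ := by
  have hW := hB.size_lt
  have hc := hB.count_lt
  have hsum : ∑ i ∈ Ico 0 n, playerVal σ.arr n i ≤ n * (d + 1) := by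
    have := sum_le_card_nsmul (Ico 0 n) (fun i => playerVal σ.arr n i) (d + 1)
      fun i hi => playerVal_le n (hB.length_le i (mem_Ico.1 hi).2)
    simpa using this
  rw [range_eq_Ico]
  refine Adds.upTo (D := n) (T := playerTime d) (by omega) (by omega) (by omega) (by omega)
    (by simp) (by simp) h₁ ?_ (by simp [Expr.cost]) ?_
  · intro σ' h
    have := (h.reg 0 (by simp)).trans h₀
    simp only [Expr.Fits, Expr.eval, this, and_true]
    omega
  · intro k σ' _ hk hr hle h
    have ha := h.arr
    rw [← ha] at hB hle hsum ⊢
    exact adds_addPlayer hB ((h.reg 0 (by simp)).trans h₀) hr hk (by omega)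

end Counting

/-! ### Recording who objects to whom -/

section Tables

theorem runs_setRows {n W : ℕ} {σ : State} (hW : (n + 1) * (n + 1) < W) (h₀ : σ.reg 0 = n)
    (h₁ : σ.reg 1 = 0) (h₂ : σ.reg 2 = 0) :
    Runs W setRows ((n + 1) * 20) σ fun σ' => (∀ r, r ≠ 1 → r ≠ 2 → σ'.reg r = σ.reg r) ∧
      (∀ a, a ≠ 5 → σ'.arr a = σ.arr a) ∧ ∀ i < n, σ'.arr 5 i = i * (n + 1) := by
  have hW' : n + 1 < W := by nlinarith
  have := Runs.upTo (W := W) (r := 1) (hi := .reg 0) (σ := σ) (T := 12) (T' := (n + 1) * 20)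
    (D := n) (lo := 0) (H := n) (p := .seq (.store 5 (.reg 1) (.reg 2))
      (incr 2 (.plus (.reg 0) (.lit 1))))
    (I := fun k σ' => σ'.reg 1 = k ∧ σ'.reg 2 = k * (n + 1) ∧
      (∀ r, r ≠ 1 → r ≠ 2 → σ'.reg r = σ.reg r) ∧
      (∀ a, a ≠ 5 → σ'.arr a = σ.arr a) ∧ ∀ i < k, σ'.arr 5 i = i * (n + 1))
    (by omega) (by omega) (by omega) (by omega) ?_ (by simp [Expr.cost]) ?_
    (by simp [h₁, h₂])
  · exact this.mono le_rfl fun σ' h => h.2.2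
  · rintro k σ' ⟨h, -, h', -⟩
    have := (h' 0 (by simp) (by simp)).trans h₀
    simp only [Expr.Fits, Expr.eval, this, and_true]
    omega
  · rintro k σ' - hk ⟨e₁, e₂, e, ea, e₅⟩
    have e₀ := (e 0 (by simp) (by simp)).trans h₀
    have hle : k * (n + 1) + (n + 1) ≤ (n + 1) * (n + 1) := by nlinarith
    refine Runs.seq 3 6 (by omega) (.store ?_ ?_ ?_ ?_)
    · simp only [Expr.Fits]; omega
    · simp only [Expr.Fits]; omega
    · simp [Expr.cost]
    refine .assign ?_ ?_ ⟨?_, ?_, ?_, ?_, ?_, ?_⟩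
    · simp only [Expr.Fits, Expr.eval, State.setArr_reg, e₁, e₂, e₀]; omega
    · simp [Expr.cost]
    · simp [e₁]
    · simp
    · simp [Expr.eval, e₀, e₂]; ring
    · intro r h1 h2; simp [h1, h2, e r h1 h2]
    · intro a ha; simp [State.setArr_arr, ha, ea a ha]
    · intro i hi
      simp only [State.setReg_arr, State.setArr_arr, if_true, Expr.eval, e₁, e₂,
        Function.update_apply]
      split_ifs with h
      · rw [h]
      · exact e₅ i (by omega)

open Classical in
/-- The array `t` holds `v` at the marks of the pairs in `S` and is `0` elsewhere. -/
def IsTable (v : ℕ) (mark : ℕ → ℕ → ℕ → Prop) (S : ℕ → ℕ → Prop) (t : ℕ → ℕ) : Prop :=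
  ∀ y, t y = if ∃ x e, S x e ∧ mark x e y then v else 0

namespace IsTable

variable {v : ℕ} {mark : ℕ → ℕ → ℕ → Prop} {S S' : ℕ → ℕ → Prop} {t : ℕ → ℕ} {x₀ e₀ y₀ : ℕ}

theorem congr (h : IsTable v mark S t) (hS : ∀ x e, S' x e ↔ S x e) : IsTable v mark S' t := by
  obtain rfl : S' = S := funext₂ fun x e => propext (hS x e)
  exact h

/-- All writes store the same value `v`, so hitting a cell repeatedly does no harm. -/
theorem update (h : IsTable v mark S t) (hS : ∀ x e, S' x e ↔ S x e ∨ x = x₀ ∧ e = e₀)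
    (hm : ∀ y, mark x₀ e₀ y ↔ y = y₀) : IsTable v mark S' (Function.update t y₀ v) := by
  classical
  intro y
  have key : (∃ x e, S' x e ∧ mark x e y) ↔ (∃ x e, S x e ∧ mark x e y) ∨ y = y₀ := by
    simp [hS, or_and_right, exists_or, and_assoc, hm]
  rw [Function.update_apply, h y]
  rw [if_congr key rfl rfl]
  by_cases hy : y = y₀ <;> simp [hy]

theorem skip (h : IsTable v mark S t) (hS : ∀ x e, S' x e ↔ S x e ∨ x = x₀ ∧ e = e₀)
    (hm : ∀ y, ¬ mark x₀ e₀ y) : IsTable v mark S' t := by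
  classical
  intro y
  have key : (∃ x e, S' x e ∧ mark x e y) ↔ ∃ x e, S x e ∧ mark x e y := by
    simp [hS, or_and_right, exists_or, and_assoc, hm]
  exact (h y).trans (if_congr key.symm rfl rfl)

theorem le (h : IsTable v mark S t) (y : ℕ) : t y ≤ v := by
  rw [h y]
  split_ifs <;> omega

/-- With `v = 0` the marks are invisible; this is how a flag switches a condition off. -/
theorem eq_zero_iff (h : IsTable v mark S t) (y : ℕ) :
    t y = 0 ↔ ¬ (v ≠ 0 ∧ ∃ x e, S x e ∧ mark x e y) := by
  rw [h y]
  split_ifs <;> simp_all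

end IsTable

/-- The place that is marked for the entry `e` of the list of `x` if it is an enemy. -/
def EnemyMark (A : ℕ → ℕ → ℕ) (x e y : ℕ) : Prop := A 2 e = 0 ∧ y = A 5 (A 1 e) + A 4 x

/-- The bound player, if any, found at the entry `e` of the list of `x`. -/
def FriendMark (A : ℕ → ℕ → ℕ) (x e y : ℕ) : Prop := A 2 e ≠ 0 ∧ A 4 x = A 4 (A 1 e) ∧ y = A 1 e

/-- Each list entry is visited once in constant time. Unmarked cells are never touched and keep
their initial zero, so the cost is governed by the lists and not by the size of the table. -/
theorem runs_setTables {n d W w b : ℕ} {σ : State} (hB : Bounds σ.arr n d W) (hw : w < W)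
    (hb : b < W) (h₀ : σ.reg 0 = n) (h₆ : ∀ x, σ.arr 6 x = 0) (h₇ : ∀ x, σ.arr 7 x = 0) :
    Runs W (setTables w b) ((n + 1) * ((d + 1) * 35 + 11) + 2) σ fun σ' =>
      σ'.reg 0 = n ∧ σ'.reg 8 = σ.reg 8 ∧ (∀ a, a ≠ 6 → a ≠ 7 → σ'.arr a = σ.arr a) ∧
      IsTable w (EnemyMark σ.arr) (fun x e => x < n ∧ e ∈ Set.Ico (σ.arr 0 x) (σ.arr 0 (x + 1)))
        (σ'.arr 6) ∧
      IsTable b (FriendMark σ.arr) (fun x e => x < n ∧ e ∈ Set.Ico (σ.arr 0 x) (σ.arr 0 (x + 1)))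
        (σ'.arr 7) := by
  have hW := hB.size_lt
  set A := σ.arr with hA
  refine Runs.seq 2 ((n + 1) * ((d + 1) * 35 + 11)) (by omega) (.assign ?_ ?_ ?_)
  · simp only [Expr.Fits]; omega
  · simp [Expr.cost]
  simp only [Expr.eval]
  let J : (ℕ → ℕ → Prop) → State → Prop := fun S σ' => σ'.reg 0 = n ∧ σ'.reg 8 = σ.reg 8 ∧
    (∀ a, a ≠ 6 → a ≠ 7 → σ'.arr a = A a) ∧ IsTable w (EnemyMark A) S (σ'.arr 6) ∧
    IsTable b (FriendMark A) S (σ'.arr 7)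
  let I : ℕ → State → Prop := fun k σ' => σ'.reg 1 = k ∧
    J (fun x e => x < k ∧ e ∈ Set.Ico (A 0 x) (A 0 (x + 1))) σ'
  refine Runs.mono (Runs.upTo (I := I) (D := n) (H := n) (lo := 0) (T := (d + 1) * 35 + 3)
    (by omega) (by omega) (by omega) (by omega) ?_ ?_ ?_ ?_) le_rfl fun σ' h => h.2
  · rintro k σ' ⟨h₁, h, -⟩
    simp only [Expr.Fits, Expr.eval, h, and_true]
    omega
  · simp [Expr.cost]
  · rintro k σ₁ - hk ⟨e₁, hJ⟩
    have ho := hB.offset_lt k hk.le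
    have ho' := hB.offset_lt (k + 1) hk
    have hA₀ := hJ.2.2.1 0 (by simp) (by simp)
    refine Runs.seq 3 ((d + 1) * 35) (by omega) (.assign ?_ ?_ ?_)
    · simp only [Expr.Fits, Expr.eval, e₁, hA₀]; omega
    · simp [Expr.cost]
    simp only [Expr.eval, e₁, hA₀]
    -- The entries visited so far: all lists before that of `k`, and the part of the list of `k`
    -- before position `m`.
    let S : ℕ → ℕ → ℕ → Prop := fun m x e =>
      e ∈ Set.Ico (A 0 x) (A 0 (x + 1)) ∧ (x < k ∨ x = k ∧ e < m)
    let I' : ℕ → State → Prop := fun m σ' => σ'.reg 6 = m ∧ σ'.reg 1 = k ∧ J (S m) σ'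
    refine Runs.mono (Runs.upTo (I := I') (D := d) (lo := A 0 k) (H := A 0 (k + 1)) (T := 20)
      (by omega) ho' (hB.mono k hk) (by have := hB.length_le k hk; omega) ?_
      (by simp only [listEnd, Expr.cost]; omega) ?_ ?_) le_rfl ?_
    · rintro m σ' ⟨h₆, h₁, hJ⟩
      simp only [listEnd, Expr.Fits, Expr.eval, h₁, hJ.2.2.1 0 (by simp) (by simp), and_true]
      omega
    · rintro m σ₂ hm hm' ⟨e₆, e₁, e₀, e₈, ea, et, eb⟩
      have hmem : m ∈ Set.Ico (A 0 k) (A 0 (k + 1)) := ⟨hm, hm'⟩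
      have hkn := hB.known_lt k hk m hmem
      have hkl := hB.label_lt _ hkn
      have hkl' := hB.label_lt _ hk
      have hks := hB.sign_lt m
      have hrow := hB.row_lt _ hkn _ hkl'.le
      have a₁ := ea 1 (by simp) (by simp)
      have a₂ := ea 2 (by simp) (by simp)
      have a₄ := ea 4 (by simp) (by simp)
      have a₅ := ea 5 (by simp) (by simp)
      have hS : ∀ x e, S (m + 1) x e ↔ S m x e ∨ x = k ∧ e = m := by
        intro x e
        simp only [S]
        constructor
        · rintro ⟨h, h' | ⟨h', h''⟩⟩
          · exact Or.inl ⟨h, Or.inl h'⟩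
          · rcases Nat.lt_succ_iff_lt_or_eq.1 h'' with h''' | h'''
            · exact Or.inl ⟨h, Or.inr ⟨h', h'''⟩⟩
            · exact Or.inr ⟨h', h'''⟩
        · rintro (⟨h, h' | ⟨h', h''⟩⟩ | ⟨rfl, rfl⟩)
          · exact ⟨h, Or.inl h'⟩
          · exact ⟨h, Or.inr ⟨h', by omega⟩⟩
          · exact ⟨hmem, Or.inr ⟨rfl, by omega⟩⟩
      refine Runs.cond 16 ?_ ?_ (fun h => Runs.cond 8 ?_ ?_ (fun h' => .store ?_ ?_ ?_ ?_)
        fun h' => .skip ?_ ?_) (fun h => .store ?_ ?_ ?_ ?_)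
      · simp only [Expr.Fits, Expr.eval, e₆, a₂]; omega
      · simp [Expr.cost]
      · simp only [Expr.Fits, Expr.eval, e₆, e₁, a₁, a₄]; omega
      · simp [Expr.cost]
      · simp only [Expr.Fits, Expr.eval, e₆, a₁]; omega
      · simpa only [Expr.Fits] using hb
      · simp [Expr.cost]
      · simp only [Expr.eval, e₆, e₁, a₁, a₂, a₄] at h h' ⊢
        have heq : A 4 k = A 4 (A 1 m) := by simpa using h'
        refine ⟨e₆, by simp, e₁, e₀, e₈, ?_, ?_, ?_⟩
        · intro a h6 h7; simp [State.setArr_arr, h7, ea a h6 h7]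
        · exact et.skip hS fun y hy => h hy.1
        · simp only [State.setReg_arr, State.setArr_arr, if_true]
          exact eb.update hS fun y => ⟨fun hy => hy.2.2, fun hy => ⟨h, heq, hy⟩⟩
      · omega
      · simp only [Expr.eval, e₆, e₁, a₁, a₄] at h'
        have heq : ¬ A 4 k = A 4 (A 1 m) := by simpa using h'
        simp only [Expr.eval, e₆, a₂] at h
        refine ⟨e₆, by simp, e₁, e₀, e₈, ea, ?_, ?_⟩
        · exact et.skip hS fun y hy => h hy.1
        · exact eb.skip hS fun y hy => heq hy.2.1
      · simp only [Expr.Fits, Expr.eval, e₆, e₁, a₁, a₄, a₅]; omega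
      · simpa only [Expr.Fits] using hw
      · simp [Expr.cost]
      · simp only [Expr.eval, e₆, e₁, a₁, a₂, a₄, a₅] at h ⊢
        refine ⟨e₆, by simp, e₁, e₀, e₈, ?_, ?_, ?_⟩
        · intro a h6 h7; simp [State.setArr_arr, h6, ea a h6 h7]
        · simp only [State.setReg_arr, State.setArr_arr, if_true]
          exact et.update hS fun y => ⟨fun hy => hy.2, fun hy => ⟨h, hy⟩⟩
        · exact eb.skip hS fun y hy => hy.1 h
    · obtain ⟨e₀, e₈, ea, et, eb⟩ := hJ
      refine ⟨by simp, e₁, e₀, e₈, ea, et.congr ?_, eb.congr ?_⟩ <;>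
      · intro x e
        simp only [S, Set.mem_Ico]
        constructor
        · rintro ⟨h, h' | ⟨rfl, h''⟩⟩
          · exact ⟨h', h⟩
          · omega
        · exact fun h => ⟨h.2, Or.inl h.1⟩
    · rintro σ₂ ⟨-, e₁, e₀, e₈, ea, et, eb⟩
      refine ⟨e₁, by simp, e₀, e₈, ea, et.congr ?_, eb.congr ?_⟩ <;>
      · intro x e
        simp only [S, Set.mem_Ico]
        constructor
        · rintro ⟨h, h'⟩
          rcases Nat.lt_succ_iff_lt_or_eq.1 h with h'' | rfl
          · exact ⟨h', Or.inl h''⟩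
          · exact ⟨h', Or.inr ⟨rfl, h'.2⟩⟩
        · rintro ⟨h, h' | ⟨rfl, h''⟩⟩
          · exact ⟨by omega, h⟩
          · exact ⟨by omega, h⟩
  · refine ⟨by simp, by simpa using h₀, by simp, fun a _ _ => rfl, fun y => ?_, fun y => ?_⟩
    · rw [if_neg (by simp)]; exact h₆ y
    · rw [if_neg (by simp)]; exact h₇ y

end Tables

/-! ### From array values to the game -/

namespace Encodes

variable {n : ℕ} {G : Game n} {Γ : CoalitionStructure n} {σ : State}

theorem exists_known (E : Encodes G Γ σ) (i : Fin n) {e : ℕ}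
    (he : e ∈ Set.Ico (σ.arr 0 i) (σ.arr 0 (i + 1))) : ∃ j ∈ G.known i, σ.arr 1 e = j := by
  obtain ⟨j, hj, h⟩ := (E.list_bijOn i).mapsTo he
  exact ⟨j, hj, h.symm⟩

theorem exists_entry (E : Encodes G Γ σ) {i j : Fin n} (hj : j ∈ G.known i) :
    ∃ e ∈ Set.Ico (σ.arr 0 i) (σ.arr 0 (i + 1)), σ.arr 1 e = j :=
  (E.list_bijOn i).surjOn ⟨j, hj, rfl⟩

/-- List positions of `i` biject with the players known to `i`, so the order of the list does not
matter. -/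
theorem sum_list (E : Encodes G Γ σ) (i : Fin n) {f : ℕ → ℕ} {g : Fin n → ℕ}
    (h : ∀ e ∈ Set.Ico (σ.arr 0 i) (σ.arr 0 (i + 1)), ∀ j ∈ G.known i, σ.arr 1 e = j → f e = g j) :
    ∑ e ∈ Ico (σ.arr 0 i) (σ.arr 0 (i + 1)), f e = ∑ j ∈ G.known i, g j := by
  have hk : ∀ e ∈ Ico (σ.arr 0 i) (σ.arr 0 (i + 1)), ∃ j ∈ G.known i, σ.arr 1 e = j :=
    fun e he => E.exists_known i (by simpa using he)
  have : Nonempty (Fin n) := ⟨i⟩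
  choose! k hk hk' using hk
  refine sum_bij (fun e _ => k e) hk ?_ ?_ ?_
  · intro e he e' he' hee
    refine (E.list_bijOn i).injOn (by simpa using he) (by simpa using he') ?_
    rw [hk' e he, hk' e' he', hee]
  · intro j hj
    obtain ⟨e, he, hej⟩ := E.exists_entry hj
    have he' : e ∈ Ico (σ.arr 0 i) (σ.arr 0 (i + 1)) := by simpa using he
    exact ⟨e, he', Fin.ext ((hk' e he').symm.trans hej)⟩
  · exact fun e he => h e (by simpa using he) _ (hk e he) (hk' e he)

theorem sum_known (i : Fin n) (g : Fin n → ℕ) :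
    ∑ j ∈ G.known i, g j = ∑ j ∈ G.friends i, g j + ∑ j ∈ G.enemies i, g j :=
  sum_union (G.disjoint i)

theorem sign_eq_zero_iff (E : Encodes G Γ σ) {i j : Fin n} {e : ℕ}
    (he : e ∈ Set.Ico (σ.arr 0 i) (σ.arr 0 (i + 1))) (hj : σ.arr 1 e = j) :
    σ.arr 2 e = 0 ↔ j ∈ G.enemies i := by
  obtain ⟨k, hk, hk'⟩ := E.exists_known i he
  obtain rfl : j = k := Fin.ext (hj.symm.trans hk')
  have hd : j ∈ G.friends i → j ∉ G.enemies i := fun h => disjoint_left.1 (G.disjoint i) h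
  rcases mem_union.1 hk with h | h
  · have := E.sign_friend i e he j h hj
    grind
  · have := E.sign_enemy i e he j h hj
    grind

open Classical in
theorem pairVal_friend (E : Encodes G Γ σ) {i j k : Fin n} {e f : ℕ}
    (he : e ∈ Set.Ico (σ.arr 0 i) (σ.arr 0 (i + 1))) (hj : σ.arr 1 e = j)
    (hf : f ∈ Set.Ico (σ.arr 0 i) (σ.arr 0 (i + 1))) (hk : σ.arr 1 f = k)
    (hF : j ∈ G.friends i) :
    pairVal σ.arr e f = if k ∈ G.friends i ∧ Strict (G.pref i) j k then 1 else 0 := by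
  have hs := E.sign_friend i e he j hF hj
  obtain ⟨k', hk₁, hk₂⟩ := E.exists_known i hf
  obtain rfl : k = k' := Fin.ext (hk.symm.trans hk₂)
  have hd : k ∈ G.friends i → k ∉ G.enemies i := fun h => disjoint_left.1 (G.disjoint i) h
  rcases mem_union.1 hk₁ with h | h
  · have hs' := E.sign_friend i f hf k h hk
    have h₁ := E.rank_iff i e he f hf j k hj hk (Or.inl ⟨hF, h⟩)
    have h₂ := E.rank_iff i f hf e he k j hk hj (Or.inl ⟨h, hF⟩)
    simp only [pairVal, hs, hs', Strict, h₁, h₂, h]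
    grind
  · have hs' := E.sign_enemy i f hf k h hk
    simp only [pairVal, hs, hs']
    grind

open Classical in
theorem pairVal_enemy (E : Encodes G Γ σ) {i j k : Fin n} {e f : ℕ}
    (he : e ∈ Set.Ico (σ.arr 0 i) (σ.arr 0 (i + 1))) (hj : σ.arr 1 e = j)
    (hf : f ∈ Set.Ico (σ.arr 0 i) (σ.arr 0 (i + 1))) (hk : σ.arr 1 f = k)
    (hE : j ∈ G.enemies i) :
    pairVal σ.arr e f = if k ∈ G.enemies i ∧ Strict (G.pref i) k j then 1 else 0 := by
  have hs := E.sign_enemy i e he j hE hj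
  obtain ⟨k', hk₁, hk₂⟩ := E.exists_known i hf
  obtain rfl : k = k' := Fin.ext (hk.symm.trans hk₂)
  have hd : k ∈ G.friends i → k ∉ G.enemies i := fun h => disjoint_left.1 (G.disjoint i) h
  rcases mem_union.1 hk₁ with h | h
  · have hs' := E.sign_friend i f hf k h hk
    simp only [pairVal, hs, hs']
    grind
  · have hs' := E.sign_enemy i f hf k h hk
    have h₁ := E.rank_iff i e he f hf j k hj hk (Or.inr ⟨hE, h⟩)
    have h₂ := E.rank_iff i f hf e he k j hk hj (Or.inr ⟨h, hE⟩)
    simp only [pairVal, hs, hs', Strict, h₁, h₂, h]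
    grind

open Classical in
theorem weightVal_friend (E : Encodes G Γ σ) {i j : Fin n} {e : ℕ}
    (he : e ∈ Set.Ico (σ.arr 0 i) (σ.arr 0 (i + 1))) (hj : σ.arr 1 e = j)
    (hF : j ∈ G.friends i) :
    weightVal σ.arr i e = 1 + #{k ∈ G.friends i | Strict (G.pref i) j k} := by
  have hd := disjoint_left.1 (G.disjoint i)
  rw [weightVal, E.sum_list i fun f hf k _ hk => E.pairVal_friend he hj hf hk hF, sum_known,
    card_filter, sum_eq_zero (s := G.enemies i), add_zero]
  · refine congrArg _ (sum_congr rfl fun k hk => ?_)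
    simp [hk]
  · intro k hk
    rw [if_neg]
    exact fun h => hd h.1 hk

open Classical in
theorem weightVal_enemy (E : Encodes G Γ σ) {i j : Fin n} {e : ℕ}
    (he : e ∈ Set.Ico (σ.arr 0 i) (σ.arr 0 (i + 1))) (hj : σ.arr 1 e = j)
    (hE : j ∈ G.enemies i) :
    weightVal σ.arr i e = 1 + #{k ∈ G.enemies i | Strict (G.pref i) k j} := by
  have hd := disjoint_left.1 (G.disjoint i)
  rw [weightVal, E.sum_list i fun f hf k _ hk => E.pairVal_enemy he hj hf hk hE, sum_known,
    card_filter, sum_eq_zero (s := G.friends i), zero_add]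
  · refine congrArg _ (sum_congr rfl fun k hk => ?_)
    simp [hk]
  · intro k hk
    rw [if_neg]
    exact fun h => hd hk h.1

/-- The entries whose sign disagrees with membership are the missing friends and the present
enemies, and their weights are the summands of `Game.delta_eq_sum`. The form of `hC` also admits a
label borne by nobody, with `C` empty. -/
theorem deltaVal_eq (E : Encodes G Γ σ) (i : Fin n) {l : ℕ} {C : Finset (Fin n)}
    (hC : ∀ j : Fin n, σ.arr 4 j = l ↔ j ∈ C) : deltaVal σ.arr i l = G.delta i C := by
  classical
  have hd := disjoint_left.1 (G.disjoint i)
  have key : deltaVal σ.arr i l = ∑ j ∈ G.known i, if j ∈ G.friends i then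
      (if j ∈ C then 0 else 1 + #{k ∈ G.friends i | Strict (G.pref i) j k}) else
      (if j ∈ C then 1 + #{k ∈ G.enemies i | Strict (G.pref i) k j} else 0) := by
    refine E.sum_list i fun e he j hj hje => ?_
    simp only [hje, hC]
    by_cases hF : j ∈ G.friends i
    · rw [E.sign_friend i e he j hF hje, E.weightVal_friend he hje hF]
      grind
    · have hE : j ∈ G.enemies i := (mem_union.1 hj).resolve_left hF
      rw [E.sign_enemy i e he j hE hje, E.weightVal_enemy he hje hE]
      grind
  rw [key, sum_known, Game.delta_eq_sum, sdiff_eq_filter, sum_filter, ← filter_mem_eq_inter,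
    sum_filter]
  congr 1
  · refine sum_congr rfl fun j hj => ?_
    grind
  · refine sum_congr rfl fun j hj => ?_
    grind

theorem part_iff (E : Encodes G Γ σ) (i j : Fin n) :
    σ.arr 4 j = σ.arr 4 i ↔ j ∈ Γ.part i := by
  rw [E.label_iff]
  constructor
  · intro h
    rw [← h]
    exact Γ.mem_part (mem_univ j)
  · exact fun h => Γ.part_eq_of_mem (Γ.part_mem.2 (mem_univ i)) h

/-- Since labels are at most `n`, division by `n + 1` recovers the row from the address, so
different pairs of player and label never share a cell. -/
theorem enemyTable_eq_zero_iff (E : Encodes G Γ σ) {A : ℕ → ℕ → ℕ} {t : ℕ → ℕ} {w : ℕ}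
    (hA : ∀ a < 5, A a = σ.arr a) (h₅ : ∀ i < n, A 5 i = i * (n + 1))
    (ht : IsTable w (EnemyMark A) (fun x e => x < n ∧ e ∈ Set.Ico (A 0 x) (A 0 (x + 1))) t)
    (i : Fin n) {l : ℕ} {C : Finset (Fin n)} (hl : l ≤ n)
    (hC : ∀ j : Fin n, σ.arr 4 j = l ↔ j ∈ C) :
    t (i * (n + 1) + l) = 0 ↔ ¬ (w ≠ 0 ∧ ∃ j ∈ C, i ∈ G.enemies j) := by
  rw [ht.eq_zero_iff]
  refine not_congr (and_congr_right fun _ => ?_)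
  simp only [EnemyMark, hA 0 (by simp), hA 1 (by simp), hA 2 (by simp), hA 4 (by simp)]
  constructor
  · rintro ⟨x, e, ⟨hx, he⟩, hs, hy⟩
    obtain ⟨j, hj, hej⟩ := E.exists_known ⟨x, hx⟩ he
    have hlx := E.label_lt ⟨x, hx⟩
    simp only at hlx
    rw [hej, h₅ j j.2] at hy
    have hij : (i : ℕ) = j := by
      have h₁ := congrArg (· / (n + 1)) hy
      simp only [mul_comm _ (n + 1), Nat.mul_add_div (Nat.succ_pos n)] at h₁
      rwa [Nat.div_eq_of_lt (by omega), Nat.div_eq_of_lt (by omega), add_zero, add_zero] at h₁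
    obtain rfl := Fin.ext hij
    refine ⟨⟨x, hx⟩, (hC _).1 ?_, (E.sign_eq_zero_iff (i := ⟨x, hx⟩) he hej).1 hs⟩
    simp only
    omega
  · rintro ⟨j, hj, hij⟩
    obtain ⟨e, he, hei⟩ := E.exists_entry (mem_union_right (G.friends j) hij)
    refine ⟨j, e, ⟨j.2, he⟩, (E.sign_eq_zero_iff he hei).2 hij, ?_⟩
    rw [hei, h₅ i i.2, (hC j).2 hj]

/-- Only the current coalition can hold a player back, so one cell per player is enough. -/
theorem friendTable_eq_zero_iff (E : Encodes G Γ σ) {A : ℕ → ℕ → ℕ} {t : ℕ → ℕ} {b : ℕ}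
    (hA : ∀ a < 5, A a = σ.arr a)
    (ht : IsTable b (FriendMark A) (fun x e => x < n ∧ e ∈ Set.Ico (A 0 x) (A 0 (x + 1))) t)
    (i : Fin n) : t i = 0 ↔ ¬ (b ≠ 0 ∧ ∃ j ∈ Γ.part i, i ∈ G.friends j) := by
  rw [ht.eq_zero_iff]
  refine not_congr (and_congr_right fun _ => ?_)
  simp only [FriendMark, hA 0 (by simp), hA 1 (by simp), hA 2 (by simp), hA 4 (by simp)]
  constructor
  · rintro ⟨x, e, ⟨hx, he⟩, hs, hl, hy⟩
    obtain ⟨j, hj, hej⟩ := E.exists_known ⟨x, hx⟩ he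
    obtain rfl : i = j := Fin.ext (hy.trans hej)
    rw [ne_eq, E.sign_eq_zero_iff (i := ⟨x, hx⟩) he hej] at hs
    rw [hej] at hl
    exact ⟨⟨x, hx⟩, (E.part_iff i ⟨x, hx⟩).1 hl, (mem_union.1 hj).resolve_right hs⟩
  · rintro ⟨j, hj, hij⟩
    obtain ⟨e, he, hei⟩ := E.exists_entry (mem_union_left (G.enemies j) hij)
    refine ⟨j, e, ⟨j.2, he⟩, ?_, ?_, hei.symm⟩
    · rw [ne_eq, E.sign_eq_zero_iff he hei]
      exact fun h => disjoint_left.1 (G.disjoint j) hij h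
    · rw [hei]
      exact (E.part_iff i j).2 hj

theorem checkVal_eq_zero_iff (E : Encodes G Γ σ) {A : ℕ → ℕ → ℕ} {w b : ℕ}
    (hA : ∀ a < 5, A a = σ.arr a) (h₅ : ∀ i < n, A 5 i = i * (n + 1))
    (h₆ : IsTable w (EnemyMark A) (fun x e => x < n ∧ e ∈ Set.Ico (A 0 x) (A 0 (x + 1))) (A 6))
    (h₇ : IsTable b (FriendMark A) (fun x e => x < n ∧ e ∈ Set.Ico (A 0 x) (A 0 (x + 1))) (A 7))
    (i : Fin n) {l : ℕ} {C : Finset (Fin n)} (hl : l ≤ n)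
    (hC : ∀ j : Fin n, σ.arr 4 j = l ↔ j ∈ C) :
    checkVal A i l = 0 ↔ ¬ (G.delta i C < G.delta i (Γ.part i) ∧
      ¬ (w ≠ 0 ∧ ∃ j ∈ C, i ∈ G.enemies j) ∧ ¬ (b ≠ 0 ∧ ∃ j ∈ Γ.part i, i ∈ G.friends j)) := by
  have hδ : ∀ l, deltaVal A i l = deltaVal σ.arr i l := fun l => by
    simp only [deltaVal, weightVal, pairVal, hA 0 (by simp), hA 1 (by simp), hA 2 (by simp),
      hA 3 (by simp), hA 4 (by simp)]
  rw [checkVal, hδ, hδ, hA 4 (by simp), h₅ i i.2, E.deltaVal_eq i hC,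
    E.deltaVal_eq i (E.part_iff i), ← E.enemyTable_eq_zero_iff hA h₅ h₆ i hl hC,
    ← E.friendTable_eq_zero_iff hA h₇ i]
  split_ifs with h
  · simp only [h, not_true, and_self]
  · simp only [h, not_false_iff]

/-- A sum of naturals vanishes iff each check does, and the checks run through exactly the targets
of `Game.stableWith_iff`. -/
theorem sum_playerVal_eq_zero_iff (E : Encodes G Γ σ) {A : ℕ → ℕ → ℕ} {w b : ℕ}
    (hA : ∀ a < 5, A a = σ.arr a) (h₅ : ∀ i < n, A 5 i = i * (n + 1))
    (h₆ : IsTable w (EnemyMark A) (fun x e => x < n ∧ e ∈ Set.Ico (A 0 x) (A 0 (x + 1))) (A 6))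
    (h₇ : IsTable b (FriendMark A) (fun x e => x < n ∧ e ∈ Set.Ico (A 0 x) (A 0 (x + 1))) (A 7)) :
    ∑ i ∈ range n, playerVal A n i = 0 ↔ G.StableWith (w ≠ 0) (b ≠ 0) Γ := by
  have key := fun (i : Fin n) (l : ℕ) (C : Finset (Fin n)) hl hC =>
    E.checkVal_eq_zero_iff hA h₅ h₆ h₇ i (l := l) (C := C) hl hC
  have hn : ∀ j : Fin n, σ.arr 4 j = n ↔ j ∈ (∅ : Finset (Fin n)) := fun j => by
    simp [(E.label_lt j).ne]
  rw [Game.stableWith_iff, sum_eq_zero_iff]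
  simp only [playerVal, Nat.add_eq_zero_iff, sum_eq_zero_iff, mem_range, hA 0 (by simp),
    hA 1 (by simp), hA 4 (by simp), mem_Ico]
  constructor
  · rintro h i C (rfl | ⟨j, hj, rfl⟩)
    · exact (key i n ∅ le_rfl hn).1 (h i i.2).1
    · obtain ⟨e, he, hej⟩ := E.exists_entry hj
      have := (h i i.2).2 e he
      rw [hej] at this
      exact (key i _ _ (E.label_lt j).le (E.part_iff j)).1 this
  · intro h i hi
    refine ⟨(key ⟨i, hi⟩ n ∅ le_rfl hn).2 (h _ _ (Or.inl rfl)), fun e he => ?_⟩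
    obtain ⟨j, hj, hej⟩ := E.exists_known ⟨i, hi⟩ he
    rw [hej]
    exact (key ⟨i, hi⟩ _ _ (E.label_lt j).le (E.part_iff j)).2 (h _ _ (Or.inr ⟨j, hj, rfl⟩))

theorem offset_le (E : Encodes G Γ σ) {d : ℕ} (hd : G.OutDegreeLE d) :
    ∀ i ≤ n, σ.arr 0 i ≤ i * d := by
  intro i
  induction i with
  | zero => simp [E.offset_zero]
  | succ i ih =>
    intro hi
    have := ih (by omega)
    have h₁ := E.offset_succ ⟨i, hi⟩
    have h₂ := hd ⟨i, hi⟩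
    rw [add_mul, one_mul]
    simp only at h₁
    omega

/-- The lists tile the addresses from `0` on; `sign_le` needs this because it bounds the sign at
every address. -/
theorem exists_list (E : Encodes G Γ σ) {e m : ℕ} (hm : m ≤ n) (he : e < σ.arr 0 m) :
    ∃ i : Fin n, e ∈ Set.Ico (σ.arr 0 i) (σ.arr 0 (i + 1)) := by
  induction m with
  | zero => simp [E.offset_zero] at he
  | succ m ih =>
    by_cases h : e < σ.arr 0 m
    · exact ih (by omega) h
    · exact ⟨⟨m, hm⟩, not_lt.1 h, he⟩

theorem sign_le (E : Encodes G Γ σ) (e : ℕ) : σ.arr 2 e ≤ 1 := by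
  by_cases he : e < σ.arr 0 n
  · obtain ⟨i, hi⟩ := E.exists_list le_rfl he
    obtain ⟨j, hj, hej⟩ := E.exists_known i hi
    rcases mem_union.1 hj with h | h
    · rw [E.sign_friend i e hi j h hej]
    · rw [E.sign_enemy i e hi j h hej]
      exact zero_le_one
  · rw [(E.list_clean e (not_lt.1 he)).2.1]
    exact zero_le_one

theorem bounds (E : Encodes G Γ σ) {d W : ℕ} (hd : G.OutDegreeLE d)
    (hW : (n + 2) ^ 2 * (d + 2) ^ 2 < W) {A : ℕ → ℕ → ℕ} (hA : ∀ a < 5, A a = σ.arr a)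
    (h₅ : ∀ i < n, A 5 i = i * (n + 1)) (h₆ : ∀ x, A 6 x ≤ 1) (h₇ : ∀ x, A 7 x ≤ 1) :
    Bounds A n d W := by
  have hn : (n + 2) ^ 2 ≤ (n + 2) ^ 2 * (d + 2) ^ 2 := Nat.le_mul_of_pos_right _ (by positivity)
  have hnd : n * (d + 1) ≤ (n + 2) ^ 2 * (d + 2) ^ 2 := Nat.mul_le_mul (by nlinarith) (by nlinarith)
  have hdd : 1 * (d * (d + 1)) ≤ (n + 2) ^ 2 * (d + 2) ^ 2 :=
    Nat.mul_le_mul (by nlinarith) (by nlinarith)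
  have hn' : n + 3 ≤ (n + 2) ^ 2 := by nlinarith
  have hsucc := fun (i : ℕ) (hi : i < n) => E.offset_succ ⟨i, hi⟩
  simp only at hsucc
  have h0 := hA 0 (by simp)
  have h1 := hA 1 (by simp)
  have h2 := hA 2 (by simp)
  have h3 := hA 3 (by simp)
  have h4 := hA 4 (by simp)
  constructor
  · intro i hi
    rw [h0, hsucc i hi]
    omega
  · intro i hi
    rw [h0, hsucc i hi]
    exact Nat.add_le_add_left (hd _) _
  · intro i hi
    have h := E.offset_le hd i hi
    have : i * d ≤ n * (d + 1) := Nat.mul_le_mul hi (by omega)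
    rw [h0]
    omega
  · intro i hi e he
    rw [h0] at he
    obtain ⟨j, -, hj⟩ := E.exists_known ⟨i, hi⟩ he
    rw [h1, hj]
    exact j.2
  · intro e
    have := E.sign_le e
    rw [h2]
    omega
  · intro e
    have := E.rank_le e
    rw [h3]
    omega
  · intro i hi
    rw [h4]
    exact E.label_lt ⟨i, hi⟩
  · intro i hi l hl
    have : i * (n + 1) ≤ n * (n + 1) := Nat.mul_le_mul_right _ hi.le
    rw [h₅ i hi]
    nlinarith
  · intro x
    have := h₆ x
    omega
  · intro x
    have := h₇ x
    omega
  · omega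
  · omega
  · omega

end Encodes

/-! ### Word size and total running time -/

/-- The base is at least `2`, so the constant `d + 2` is absorbed into the exponent, even for `n =
0`; words keep `O(log n)` bits for fixed `d`. -/
theorem sq_mul_sq_lt_pow (n d : ℕ) : (n + 2) ^ 2 * (d + 2) ^ 2 < (n + 2) ^ (2 * d + 5) := by
  have h₁ : d + 2 ≤ 2 ^ (d + 1) := Nat.lt_two_pow_self
  have h₂ : d + 2 ≤ (n + 2) ^ (d + 1) := h₁.trans (Nat.pow_le_pow_left (by omega) _)
  have h₃ : (d + 2) ^ 2 ≤ ((n + 2) ^ (d + 1)) ^ 2 := Nat.pow_le_pow_left h₂ 2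
  calc (n + 2) ^ 2 * (d + 2) ^ 2 ≤ (n + 2) ^ 2 * ((n + 2) ^ (d + 1)) ^ 2 :=
        Nat.mul_le_mul_left _ h₃
    _ = (n + 2) ^ (2 * d + 4) := by ring
    _ < (n + 2) ^ (2 * d + 5) := Nat.pow_lt_pow_right (by omega) (by omega)

/-- The running time of `stability` per player. -/
def stabilityTime (d : ℕ) : ℕ := 20 + ((d + 1) * 35 + 11) + (playerTime d + 8) + 20

theorem runs_stability {n d w b W : ℕ} {G : Game n} {Γ : CoalitionStructure n} {σ : State}
    (E : Encodes G Γ σ) (hd : G.OutDegreeLE d) (hw : w ≤ 1) (hb : b ≤ 1)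
    (hW : (n + 2) ^ 2 * (d + 2) ^ 2 < W) :
    Runs W (stability w b) ((n + 1) * stabilityTime d) σ fun σ' =>
      (G.StableWith (w ≠ 0) (b ≠ 0) Γ → σ'.reg 0 = 1) ∧
      (¬ G.StableWith (w ≠ 0) (b ≠ 0) Γ → σ'.reg 0 = 0) := by
  have hW' : (n + 1) * (n + 1) + 2 < W := by
    have hn : (n + 2) ^ 2 ≤ (n + 2) ^ 2 * (d + 2) ^ 2 :=
      Nat.le_mul_of_pos_right _ (by positivity)
    nlinarith
  have hT : (n + 1) * 20 + (((n + 1) * ((d + 1) * 35 + 11) + 2) +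
      (2 + ((n + 1) * (playerTime d + 8) + 4))) ≤ (n + 1) * stabilityTime d := by
    -- The last summand pays for the single assignments between and after the loops.
    have : (n + 1) * stabilityTime d = (n + 1) * 20 + (n + 1) * ((d + 1) * 35 + 11) +
      (n + 1) * (playerTime d + 8) + (n + 1) * 20 := by rw [stabilityTime]; ring
    omega
  refine Runs.seq _ _ hT ((runs_setRows (by omega) E.size (E.reg_clean 1 (by simp))
    (E.reg_clean 2 (by simp))).mono le_rfl ?_)
  rintro σ₁ ⟨r₁, a₁, rows⟩
  have hA₁ : ∀ a < 5, σ₁.arr a = σ.arr a := fun a ha => a₁ a (by omega)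
  have z₆ : ∀ x, σ₁.arr 6 x = 0 := fun x => by rw [a₁ 6 (by simp), E.arr_clean 6 (by simp)]
  have z₇ : ∀ x, σ₁.arr 7 x = 0 := fun x => by rw [a₁ 7 (by simp), E.arr_clean 7 (by simp)]
  have hB₁ : Bounds σ₁.arr n d W := E.bounds hd hW hA₁ rows (by simp [z₆]) (by simp [z₇])
  refine Runs.seq _ _ le_rfl ((runs_setTables hB₁ (by omega) (by omega)
    ((r₁ 0 (by simp) (by simp)).trans E.size) z₆ z₇).mono le_rfl ?_)
  rintro σ₂ ⟨e₀, e₈, a₂, t₆, t₇⟩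
  have hA₂ : ∀ a < 5, σ₂.arr a = σ.arr a := fun a ha =>
    (a₂ a (by omega) (by omega)).trans (hA₁ a ha)
  have rows₂ : ∀ i < n, σ₂.arr 5 i = i * (n + 1) := by
    rw [a₂ 5 (by simp) (by simp)]
    exact rows
  have hB₂ : Bounds σ₂.arr n d W := E.bounds hd hW hA₂ rows₂ (fun x => (t₆.le x).trans hw)
    (fun x => (t₇.le x).trans hb)
  -- Marks depend only on arrays below 6, which filling the tables leaves intact.
  have m₆ : EnemyMark σ₁.arr = EnemyMark σ₂.arr := by
    simp [funext_iff, EnemyMark, a₂]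
  have m₇ : FriendMark σ₁.arr = FriendMark σ₂.arr := by
    simp [funext_iff, FriendMark, a₂]
  rw [m₆, ← a₂ 0 (by simp) (by simp)] at t₆
  rw [m₇, ← a₂ 0 (by simp) (by simp)] at t₇
  have hsum := E.sum_playerVal_eq_zero_iff hA₂ rows₂ t₆ t₇
  refine Runs.seq _ _ le_rfl (.assign ?_ ?_ ?_)
  · simp only [Expr.Fits]; omega
  · simp [Expr.cost]
  simp only [Expr.eval]
  have h₈ : σ₂.reg 8 = 0 :=
    e₈.trans ((r₁ 8 (by simp) (by simp)).trans (E.reg_clean 8 (by simp)))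
  have key := adds_players (σ := σ₂.setReg 1 0) (n := n) hB₂ e₀ (by simp) h₈
  refine Runs.seq _ _ le_rfl (key.mono le_rfl ?_)
  rintro σ₃ ⟨s₈, -⟩
  have s₈' : σ₃.reg 8 = ∑ i ∈ range n, playerVal σ₂.arr n i := by
    simpa [h₈] using s₈
  have hle : ∑ i ∈ range n, playerVal σ₂.arr n i ≤ n * (d + 1) := by
    have := sum_le_card_nsmul (range n) (fun i => playerVal σ₂.arr n i) (d + 1)
      fun i hi => playerVal_le n (hB₂.length_le i (mem_range.1 hi))
    simpa using this
  have hc := hB₂.count_lt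
  refine .assign ?_ ?_ ?_
  · simp only [Expr.Fits]; omega
  · simp [Expr.cost]
  · rw [← hsum]
    simp [Expr.eval, s₈']

theorem decidesInTime_stability {w b d : ℕ} (hw : w ≤ 1) (hb : b ≤ 1)
    {K : ∀ n : ℕ, Game n → Prop} (hK : ∀ n G, K n G → G.OutDegreeLE d)
    {Q : ∀ n : ℕ, Game n → CoalitionStructure n → Prop}
    (hQ : ∀ n G Γ, Q n G Γ ↔ G.StableWith (w ≠ 0) (b ≠ 0) Γ) {g : ℕ → ℝ}
    (hg : (fun n : ℕ => (n : ℝ)) =O[Filter.atTop] g) :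
    (stability w b).DecidesInTime K Q g := by
  refine ⟨2 * d + 5, fun n => (n + 1) * stabilityTime d, ?_, ?_⟩
  · refine Asymptotics.IsBigO.trans ?_ hg
    -- The factor `2` comes from `n + 1 ≤ 2 * n` for `n ≥ 1`.
    refine Asymptotics.IsBigO.of_bound (2 * stabilityTime d) ?_
    filter_upwards [Filter.eventually_ge_atTop 1] with n hn
    have : (1 : ℝ) ≤ n := by exact_mod_cast hn
    have hs : (0 : ℝ) ≤ stabilityTime d := Nat.cast_nonneg _
    push_cast
    rw [Real.norm_of_nonneg (by positivity), Real.norm_of_nonneg (by positivity)]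
    nlinarith
  · intro n G Γ hG σ E
    obtain ⟨t, σ', h₁, h₂, h₃⟩ := runs_stability E (hK n G hG) hw hb (sq_mul_sq_lt_pow n d)
    refine ⟨t, σ', h₁, h₂, ?_⟩
    rwa [hQ]

end FEN

theorem mainTheorem4 :
    (∃ p : FEN.Prog, ∀ d : ℕ,
      p.DecidesInTime (fun _ G => G.OutDegreeLE d)
        (fun _ G Γ => G.NashStable Γ) (fun n => (n : ℝ))) ∧
    (∃ p : FEN.Prog, ∀ d k : ℕ,
      p.DecidesInTime (fun _ G => G.OutDegreeLE d ∧ G.InDegreeLE k)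
        (fun _ G Γ => G.IndividuallyStable Γ) (fun n => (n : ℝ))) ∧
    (∃ p : FEN.Prog, ∀ d k : ℕ,
      p.DecidesInTime (fun _ G => G.OutDegreeLE d ∧ G.InDegreeLE k)
        (fun _ G Γ => G.ContractuallyIndividuallyStable Γ) (fun n => (n : ℝ))) ∧
    (∃ p : FEN.Prog, ∀ d : ℕ,
      p.DecidesInTime (fun _ G => G.OutDegreeLE d)
        (fun _ G Γ => G.IndividuallyStable Γ) (fun n => (n : ℝ) ^ 2)) ∧
    (∃ p : FEN.Prog, ∀ d : ℕ,
      p.DecidesInTime (fun _ G => G.OutDegreeLE d)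
        (fun _ G Γ => G.ContractuallyIndividuallyStable Γ) (fun n => (n : ℝ) ^ 2)) := by
  have linear : (fun n : ℕ => (n : ℝ)) =O[Filter.atTop] fun n : ℕ => (n : ℝ) :=
    Asymptotics.isBigO_refl _ _
  have square : (fun n : ℕ => (n : ℝ)) =O[Filter.atTop] fun n : ℕ => (n : ℝ) ^ 2 := by
    refine Asymptotics.IsBigO.of_bound 1 (Filter.Eventually.of_forall fun n => ?_)
    rw [Real.norm_of_nonneg (by positivity), Real.norm_of_nonneg (by positivity), one_mul]
    exact_mod_cast Nat.le_self_pow two_ne_zero n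
  -- Flags `0 0` impose no consent, `1 0` require that of the joined coalition, and `1 1` also that
  -- of the abandoned one.
  refine ⟨⟨.stability 0 0, fun d => ?_⟩, ⟨.stability 1 0, fun d k => ?_⟩,
    ⟨.stability 1 1, fun d k => ?_⟩, ⟨.stability 1 0, fun d => ?_⟩, ⟨.stability 1 1, fun d => ?_⟩⟩
  · exact FEN.decidesInTime_stability (by simp) (by simp) (fun _ _ h => h)
      (fun _ G Γ => by simpa using G.nashStable_iff) linear
  · exact FEN.decidesInTime_stability (by simp) (by simp) (fun _ _ h => h.1)
      (fun _ G Γ => by simpa using G.individuallyStable_iff) linear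
  · exact FEN.decidesInTime_stability (by simp) (by simp) (fun _ _ h => h.1)
      (fun _ G Γ => by simpa using G.contractuallyIndividuallyStable_iff) linear
  · exact FEN.decidesInTime_stability (by simp) (by simp) (fun _ _ h => h)
      (fun _ G Γ => by simpa using G.individuallyStable_iff) square
  · exact FEN.decidesInTime_stability (by simp) (by simp) (fun _ _ h => h)
      (fun _ G Γ => by simpa using G.contractuallyIndividuallyStable_iff) square
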